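/- **Setting.** Let $\mathcal Z=\bigsqcup_j \mathcal Z_j$ be a smooth link in a Riemannian 3-manifold $(Y,g)$, let $(t,z)=(t,x,y)$ be Fermi coordinates ($t$ arclength on $\mathcal Z_j$, of length $L_j$; $z=x+iy$ in an orthonormal normal frame) identifying the tube $N_{r_0}(\mathcal Z)$ with $\bigsqcup_j \mathbb R/L_j\mathbb Z\times\{|z|<r_0\}$, with $r_0$ less than a radius up to which the coordinates are defined, and let $r=|z|=\mathrm{dist}(\cdot,\mathcal Z)$. Over $N_{r_0}(\mathcal Z)-\mathcal Z$, spinors are $\mathbb C^2$-valued functions, with connection $\nabla=d+\tfrac i2d\theta+\mathfrak a$, where $\mathfrak a$ is a smooth bounded 1-form valued in real linear endomorphisms; $\nabla_t,\nabla_x,\nabla_y$ are its components, and $L^2(N_{r_0})$ is taken with the Riemannian volume. Set $\|\psi\|_{rH^1_e}^2=\int_{N_{r_0}-\mathcal Z}\big(|\nabla\psi|^2+|\psi|^2/r^2\big)dV$, with weak derivatives. A smooth section $\eta$ of the normal bundle is a smooth $\mathbb C$-valued function on $\bigsqcup_j\mathbb R/L_j\mathbb Z$, with Fourier coefficients $\eta_{j,p}$,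 and for $s\in\mathbb R$ put $\|\eta\|_s^2=\sum_jL_j\sum_{p\in\mathbb Z}(1+(2\pi p/L_j)^2)^s|\eta_{j,p}|^2$. Fix $R_0>0$, a smooth cut-off $\chi$ with $\chi=1$ for $r\le R_0$ and $\chi=0$ for $r\ge 2R_0$, and a smooth cut-off $\chi_{r_0}$ with $\chi_{r_0}=1$ for $r\le r_0/2$ and $\chi_{r_0}=0$ for $r\ge r_0$. Set $\chi_p(r)=\chi(|p|r)\chi_{r_0}(r)$. For a multi-index $\partial^m$ of order $m$ in $\partial_t,\partial_x,\partial_y$ put, on the $j$-th component, $$\underline{\partial^m\chi}[\eta](t,z)=\sum_{p\in\mathbb Z}(\partial^m\chi_p)(z)\,\eta_{j,p}\,e^{2\pi ipt/L_j}.$$ Fix a bounded continuous field $\sigma$ of real linear endomorphisms of the spinor bundle over $N_{r_0}(\mathcal Z)-\mathcal Z$, and $\beta\in\mathbb R$. All constants $C$ below are independent of $\eta$. **(A)** Let $\alpha>0$ and let $\Phi$ be a smooth spinor on $N_{r_0}-\mathcal Z$ such that for every $k\ge0$ there are constants with $|\nabla_t^k\Phi|\le C_kr^\alpha$ and $|\nabla_t^k\nabla_v\Phi|\le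 C_kr^{\alpha-1}$ for $v=\partial_x,\partial_y$. Let $D\Phi$ be $\nabla_t^k\Phi$ (order $k$, $l=0$) or $\nabla_t^{k-1}\nabla_v\Phi$ with $k\ge1$ (order $k$, $l=1$), and let $M_\Phi(\eta)=\underline{\partial^m\chi}[d_t^n\eta]\,\sigma D\Phi$, of weight $w_A=m+n+k$. If $m\ge1$ or $\alpha+\beta-l>-1$, then $$\|r^\beta M_\Phi(\eta)\|_{L^2(N_{r_0})}\le C\|\eta\|_{w_A-(1+\alpha+\beta)}$$ for all smooth $\eta$, where $C$ depends on $\Phi$ only through the constants in its bounds. In particular, for $a,b\in\{t,x,y\}$: * if $\alpha+\beta>-1$, then $\|\underline\chi[\eta'']\sigma r^\beta\Phi\|_{L^2}+\|\underline{\partial_a\chi}[\eta']\sigma r^\beta\Phi\|_{L^2}+\|\underline{\partial_{ab}\chi}[\eta]\sigma r^\beta\Phi\|_{L^2}\le C\|\eta\|_{1-\alpha-\beta}$; * if $\alpha+\beta>-1$, and $\alpha+\beta>0$ in case $b\ne t$, then $\|\underline\chi[\eta']\sigma r^\beta\nabla_b\Phi\|_{L^2}+\|\underline{\partial_a\chi}[\eta]\sigma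 r^\beta\nabla_b\Phi\|_{L^2}\le C\|\eta\|_{1-\alpha-\beta}$. **(B)** Let $\gamma>0$, let $k\in\{0,1\}$, and for $\psi\in rH^1_e$ let $M_\psi(\eta)=\underline{\partial^m\chi}[d_t^n\eta]\,\sigma\nabla^k\psi$ (with $\nabla^1\psi$ any $\nabla_b\psi$, $b=t,x,y$), of weight $w_B=m+n+k$. If $m\ge1$ or $\beta\ge k-1$, then $$\|r^\beta M_\psi(\eta)\|_{L^2(N_{r_0})}\le C\|\eta\|_{w_B+\gamma-(1/2+\beta)}\|\psi\|_{rH^1_e}$$ for all smooth $\eta$ and all $\psi\in rH^1_e$, with $C$ independent of $\psi$. In particular, for $a,b\in\{t,x,y\}$: * if $\beta\ge-1$, then $\|\underline\chi[\eta'']\sigma\psi r^\beta\|_{L^2}+\|\underline{\partial_a\chi}[\eta']\sigma\psi r^\beta\|_{L^2}+\|\underline{\partial_{ab}\chi}[\eta]\sigma\psi r^\beta\|_{L^2}\le C\|\eta\|_{3/2+\gamma-\beta}\|\psi/r\|_{L^2}$; * if $\beta\ge0$, then $\|\underline\chi[\eta']\sigma r^\beta\nabla_b\psi\|_{L^2}+\|\underline{\partial_a\chi}[\eta]\sigma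 r^\beta\nabla_b\psi\|_{L^2}\le C\|\eta\|_{3/2+\gamma-\beta}\|\nabla\psi\|_{L^2}$. -/

import Mathlib

open MeasureTheory Set
open scoped ENNReal NNReal ContDiff

noncomputable section

namespace ModeDeformation

/-- The fibre `ℂ²` of `S^Re`, in the coordinates `(α, β)` of the trivialization of `S^Re` over the
tube that accompanies a system of Fermi coordinates. -/
abbrev Spinor : Type := EuclideanSpace ℂ (Fin 2)

/-- The coordinate vectors `∂_t, ∂_x, ∂_y` (indices `0, 1, 2`) on the universal cover
`{(t, z) : t ∈ ℝ, z = x + i y}` of one component of the tube. -/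
def dir : Fin 3 → ℝ × ℂ := ![(1, 0), (0, 1), (0, Complex.I)]

/-- The components of the closed form `dθ = (x dy - y dx) / r²` in the directions `t, x, y`. -/
def dTheta (a : Fin 3) (w : ℝ × ℂ) : ℝ :=
  ![0, -w.2.im / ‖w.2‖ ^ 2, w.2.re / ‖w.2‖ ^ 2] a

/-- The punctured solid cylinder `{0 < |z| < ρ}` (all `t ∈ ℝ`). -/
def punctured (ρ : ℝ) : Set (ℝ × ℂ) := {w | 0 < ‖w.2‖ ∧ ‖w.2‖ < ρ}

/-- The geometry of a tubular neighbourhood `N_{r₀}(𝒵) = ⊔_j S¹ × D_{r₀}` of a link `𝒵` in a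
Riemannian 3-manifold, written in Fermi coordinates `(t, z) ↦ Exp_{p_j(t)}(x n₁ + y n₂)`, where
`t` is arclength on the component `𝒵_j` of length `len j`, together with the connection of
`S^Re → N_{r₀}(𝒵) - 𝒵`. Functions on the component `j` are functions of
`(t, z) ∈ ℝ × ℂ` that are periodic in `t`. -/
structure FermiTube (ι : Type*) where
  /-- The lengths of the components of `𝒵`. -/
  len : ι → ℝ
  len_pos : ∀ j, 0 < len j
  /-- The radius `r₀` of the tube. -/
  r₀ : ℝ
  r₀_pos : 0 < r₀
  /-- A radius, such as the injectivity radius, up to which Fermi coordinates are defined. -/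
  R : ℝ
  r₀_lt : r₀ < R
  /-- The matrix `g_{ab}` of the metric in the coordinates `t, x, y`. -/
  g : ι → ℝ × ℂ → Matrix (Fin 3) (Fin 3) ℝ
  g_smooth : ∀ j a b, ContDiffOn ℝ ∞ (fun w => g j w a b) {w | ‖w.2‖ < R}
  g_posDef : ∀ j w, ‖w.2‖ < R → (g j w).PosDef
  g_periodic : ∀ j, Function.Periodic (g j) (len j, 0)
  /-- On `𝒵` the frame `∂_t, ∂_x, ∂_y` is orthonormal. -/
  g_core : ∀ j t, g j (t, 0) = 1
  /-- Gauss lemma, `g(∂_r, ·) = dr`: the rays normal to `𝒵` are unit speed geodesics, and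
  `r = |z|` is the distance to `𝒵`. -/
  g_radial : ∀ j w, ‖w.2‖ < R →
    (g j w).mulVec ![0, w.2.re, w.2.im] = ![0, w.2.re, w.2.im]
  /-- The bounded remainder `O(1)` of the connection `∇ = d + (i/2) dθ + O(1)` of `S^Re`. It is only
  real linear, because of the perturbation of the spin connection. -/
  rem : ι → Fin 3 → ℝ × ℂ → (Spinor →L[ℝ] Spinor)
  rem_smooth : ∀ j a, ContDiffOn ℝ ∞ (rem j a) (punctured r₀)
  rem_periodic : ∀ j a, Function.Periodic (rem j a) (len j, 0)
  rem_bounded : ∃ K : ℝ, ∀ j a, ∀ w ∈ punctured r₀, ‖rem j a w‖ ≤ K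

/-- Two smooth radial cut-off functions: `χ` is `1` for `r ≤ R₀` and vanishes for `r ≥ 2 R₀`,
`χ₀` (which is `χ_{r₀}`) is `1` for `r ≤ r₀ / 2` and vanishes for `r ≥ r₀`. -/
structure CutOffs (r₀ : ℝ) where
  R₀ : ℝ
  R₀_pos : 0 < R₀
  χ : ℝ → ℝ
  χ_smooth : ContDiff ℝ ∞ χ
  χ_one : ∀ r ≤ R₀, χ r = 1
  χ_zero : ∀ r, 2 * R₀ ≤ r → χ r = 0
  χ₀ : ℝ → ℝ
  χ₀_smooth : ContDiff ℝ ∞ χ₀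
  χ₀_one : ∀ r ≤ r₀ / 2, χ₀ r = 1
  χ₀_zero : ∀ r, r₀ ≤ r → χ₀ r = 0

/-- `χ_p(r) = χ(|p| r) χ_{r₀}(r)`, as a function on the tube. -/
def CutOffs.mode {r₀ : ℝ} (c : CutOffs r₀) (p : ℤ) (w : ℝ × ℂ) : ℝ :=
  c.χ (|(p : ℝ)| * ‖w.2‖) * c.χ₀ ‖w.2‖

/-- The iterated partial derivative `∂_{μ 0} ⋯ ∂_{μ (m-1)} χ_p` in the directions `t, x, y`. -/
def CutOffs.modeDeriv {r₀ : ℝ} (c : CutOffs r₀) {m : ℕ} (μ : Fin m → Fin 3) (p : ℤ)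
    (w : ℝ × ℂ) : ℝ :=
  iteratedFDeriv ℝ m (c.mode p) w (fun i => dir (μ i))

/-- The `p`-th Fourier coefficient of a function of period `L`. -/
def fourierMode (L : ℝ) (η : ℝ → ℂ) (p : ℤ) : ℂ :=
  (1 / L : ℂ) * ∫ t in (0 : ℝ)..L, Complex.exp (-(2 * Real.pi * p * t / L : ℝ) * Complex.I) * η t

/-- The operator `η ↦ ∑_p f_p η_p e^{ipt}` given by a family of multipliers `f_p` (with
`e^{2π i p t / L}` for a circle of length `L`). -/
def modeOp (L : ℝ) (f : ℤ → ℝ × ℂ → ℝ) (η : ℝ → ℂ) (w : ℝ × ℂ) : ℂ :=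
  ∑' p : ℤ, (f p w : ℂ) * fourierMode L η p *
    Complex.exp ((2 * Real.pi * p * w.1 / L : ℝ) * Complex.I)

namespace FermiTube

variable {ι : Type*} (T : FermiTube ι)

/-- A smooth section `η` of the normal bundle `N𝒵`, in the frame `n₁, n₂`, that is, `η = x + i y`. -/
def IsSmoothSection (η : ι → ℝ → ℂ) : Prop :=
  ∀ j, ContDiff ℝ ∞ (η j) ∧ Function.Periodic (η j) (T.len j)

/-- The `L^{s,2}`-norm on `𝒵`, `s ∈ ℝ`. -/
def sobolevNorm [Fintype ι] (s : ℝ) (η : ι → ℝ → ℂ) : ℝ≥0∞ :=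
  (∑ j, ENNReal.ofReal (T.len j) * ∑' p : ℤ,
    ENNReal.ofReal ((1 + (2 * Real.pi * p / T.len j) ^ 2) ^ s) *
      ‖fourierMode (T.len j) (η j) p‖ₑ ^ 2) ^ (1 / 2 : ℝ)

/-- The integral over `N_{r₀}(𝒵) - 𝒵` of a nonnegative function, for the Riemannian volume
`√(det g) dt dx dy`. -/
def tubeIntegral [Fintype ι] (F : ι → ℝ × ℂ → ℝ≥0∞) : ℝ≥0∞ :=
  ∑ j, ∫⁻ w in {w | w ∈ punctured T.r₀ ∧ w.1 ∈ Ioc 0 (T.len j)},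
    F j w * ENNReal.ofReal (Real.sqrt (T.g j w).det)

/-- The norm of `L²(N_{r₀}(𝒵))`. -/
def tubeL2 [Fintype ι] (f : ι → ℝ × ℂ → Spinor) : ℝ≥0∞ :=
  (T.tubeIntegral fun j w => ‖f j w‖ₑ ^ 2) ^ (1 / 2 : ℝ)

/-- The connection form of `∇ = d + (i/2) dθ + O(1)` in the direction `a`. -/
def connForm (j : ι) (a : Fin 3) (w : ℝ × ℂ) (v : Spinor) : Spinor :=
  (Complex.I / 2 * (dTheta a w : ℂ)) • v + T.rem j a w v

/-- The covariant derivative `∇_a` of a differentiable spinor, `a = t, x, y`. -/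
def covD (a : Fin 3) (Φ : ι → ℝ × ℂ → Spinor) : ι → ℝ × ℂ → Spinor :=
  fun j w => fderiv ℝ (Φ j) w (dir a) + T.connForm j a w (Φ j w)

/-- A smooth spinor on `N_{r₀}(𝒵) - 𝒵`. -/
def IsSmoothSpinor (Φ : ι → ℝ × ℂ → Spinor) : Prop :=
  ∀ j, ContDiffOn ℝ ∞ (Φ j) (punctured T.r₀) ∧ Function.Periodic (Φ j) (T.len j, 0)

/-- A bounded continuous field of (real linear) endomorphisms of `S^Re`. -/
def IsEndomorphism (σ : ι → ℝ × ℂ → (Spinor →L[ℝ] Spinor)) : Prop :=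
  (∀ j, ContinuousOn (σ j) (punctured T.r₀) ∧ Function.Periodic (σ j) (T.len j, 0)) ∧
    ∃ K : ℝ, ∀ j, ∀ w ∈ punctured T.r₀, ‖σ j w‖ ≤ K

end FermiTube

/-- The derivatives of a spinor with at most one factor normal to `𝒵`: `∇_t^k`, and
`∇_t^k ∇_v` with `v = ∂_x` or `∂_y`. -/
inductive SpinorDeriv : Type
  | tangential (k : ℕ) : SpinorDeriv
  | mixed (k : ℕ) (v : Fin 2) : SpinorDeriv

/-- The total number of derivatives. -/
def SpinorDeriv.order : SpinorDeriv → ℕ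
  | .tangential k => k
  | .mixed k _ => k + 1

/-- The number of normal derivatives. -/
def SpinorDeriv.normalOrder : SpinorDeriv → ℕ
  | .tangential _ => 0
  | .mixed _ _ => 1

namespace FermiTube

variable {ι : Type*} (T : FermiTube ι)

/-- The derivative of `Φ` described by `d`. -/
def applyDeriv (d : SpinorDeriv) (Φ : ι → ℝ × ℂ → Spinor) : ι → ℝ × ℂ → Spinor :=
  match d with
  | .tangential k => (T.covD 0)^[k] Φ
  | .mixed k v => (T.covD 0)^[k] (T.covD v.succ Φ)

/-- `|∇_t^k Φ| ≤ K r^α` and `|∇_t^k ∇_v Φ| ≤ K r^{α-1}` for all `k` and `v = ∂_x, ∂_y`, with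
constants `K` that depend on the derivative. -/
def HasSpinorBounds (α : ℝ) (K : SpinorDeriv → ℝ) (Φ : ι → ℝ × ℂ → Spinor) : Prop :=
  T.IsSmoothSpinor Φ ∧ ∀ d : SpinorDeriv, ∀ j, ∀ w ∈ punctured T.r₀,
    ‖T.applyDeriv d Φ j w‖ ≤ K d * ‖w.2‖ ^ (α - d.normalOrder)

/-- The weighted term `r^β M` with `M = \underline{∂^μ χ}[d_t^n η] σ Ψ`. -/
def term (c : CutOffs T.r₀) (β : ℝ) {m : ℕ} (μ : Fin m → Fin 3) (n : ℕ)
    (σ : ι → ℝ × ℂ → (Spinor →L[ℝ] Spinor)) (Ψ : ι → ℝ × ℂ → Spinor) (η : ι → ℝ → ℂ) :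
    ι → ℝ × ℂ → Spinor :=
  fun j w => (‖w.2‖ ^ β : ℝ) •
    (modeOp (T.len j) (c.modeDeriv μ) (iteratedDeriv n (η j)) w • σ j w (Ψ j w))

/-- `Dψ a` is the weak covariant derivative `∇_a ψ` on `N_{r₀}(𝒵) - 𝒵`, for `a = t, x, y`:
`Dψ a` minus the connection form applied to `ψ` is the distributional derivative of `ψ`. -/
def IsWeakCovD (ψ : ι → ℝ × ℂ → Spinor) (Dψ : Fin 3 → ι → ℝ × ℂ → Spinor) : Prop :=
  ∀ j, LocallyIntegrableOn (ψ j) (punctured T.r₀) ∧ ∀ a,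
    LocallyIntegrableOn (Dψ a j) (punctured T.r₀) ∧
    ∀ φ : ℝ × ℂ → ℝ, ContDiff ℝ ∞ φ → HasCompactSupport φ → tsupport φ ⊆ punctured T.r₀ →
      ∫ w, fderiv ℝ φ w (dir a) • ψ j w =
        -∫ w, φ w • (Dψ a j w - T.connForm j a w (ψ j w))

/-- `|∇ψ|²` at a point, for the metric `g` on covectors. -/
def gradSq (Dψ : Fin 3 → ι → ℝ × ℂ → Spinor) (j : ι) (w : ℝ × ℂ) : ℝ :=
  ∑ a, ∑ b, (T.g j w)⁻¹ a b * (inner ℂ (Dψ a j w) (Dψ b j w)).re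

/-- `‖∇ψ‖_{L²}` on the tube. -/
def gradL2 [Fintype ι] (Dψ : Fin 3 → ι → ℝ × ℂ → Spinor) : ℝ≥0∞ :=
  (T.tubeIntegral fun j w => ENNReal.ofReal (T.gradSq Dψ j w)) ^ (1 / 2 : ℝ)

/-- `‖ψ / r‖_{L²}` on the tube. -/
def quotL2 [Fintype ι] (ψ : ι → ℝ × ℂ → Spinor) : ℝ≥0∞ :=
  T.tubeL2 fun j w => (‖w.2‖⁻¹ : ℝ) • ψ j w

/-- The `r H¹_e`-norm `(∫ |∇ψ|² + |ψ|² / r²)^{1/2}` on the tube. -/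
def edgeNorm [Fintype ι] (ψ : ι → ℝ × ℂ → Spinor) (Dψ : Fin 3 → ι → ℝ × ℂ → Spinor) : ℝ≥0∞ :=
  (T.tubeIntegral fun j w =>
    ENNReal.ofReal (T.gradSq Dψ j w) + ENNReal.ofReal (‖ψ j w‖ ^ 2 / ‖w.2‖ ^ 2)) ^ (1 / 2 : ℝ)

/-- `ψ ∈ r H¹_e(N_{r₀}(𝒵) - 𝒵; S^Re)`, with weak covariant derivative `Dψ`. -/
def MemEdgeH1 [Fintype ι] (ψ : ι → ℝ × ℂ → Spinor) (Dψ : Fin 3 → ι → ℝ × ℂ → Spinor) : Prop :=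
  (∀ j, Function.Periodic (ψ j) (T.len j, 0)) ∧ T.IsWeakCovD ψ Dψ ∧ T.edgeNorm ψ Dψ ≠ ⊤

end FermiTube

end ModeDeformation

end

/-! With `⟨p⟩ = modeWeight L p`, the multiplier `∂^m χ_p` is `O(⟨p⟩^m)` and lives where `r ≲ ⟨p⟩⁻¹`,
even `r ∼ ⟨p⟩⁻¹` if `m ≥ 1` (`CutOffs.exists_modeDeriv_bounds`). So every derivative costs a factor
`⟨p⟩` and every power of `r` gains `⟨p⟩⁻¹`.

For (A), the spinor is replaced by its bound `r^(α-l)`, which leaves the weight `r^δ` with `δ = α +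
β - l`. At fixed `z ≠ 0` the mode sum is a trigonometric polynomial in `t`, so Parseval decouples
the modes, and `∫ r^(2δ)` over a disc or annulus of size `⟨p⟩⁻¹` is a multiple of `⟨p⟩^(-2-2δ)` by
scaling (`CutOffs.exists_lintegral_modeOp_le`). The area factor is the extra `1` in `1 + α + β`; `δ
> -1` is integrability at the core, needed only when `m = 0`.

For (B), the spinor is only `L²` after division by a power of `r`, so the mode sum times `r^δ` has
to be bounded pointwise, with `δ = β + 1` for `ψ` and `δ = β` for `∇ψ`. Cauchy–Schwarz against the
convergent sum of `⟨p⟩^(-1-2γ)` does this at the cost of `1/2 + γ` derivatives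
(`CutOffs.exists_modeOp_le`). For `m = 0` the support reaches the core, hence `δ ≥ 0`. -/

noncomputable section

namespace ModeDeformation

/-! ### Frequency weights. -/

/-- The frequency weight `⟨p⟩ = (1 + (2πp/L)²)^{1/2}` of the `p`-th mode on a circle of length `L`. -/
def modeWeight (L : ℝ) (p : ℤ) : ℝ := Real.sqrt (1 + (2 * Real.pi * p / L) ^ 2)

lemma one_le_modeWeight (L : ℝ) (p : ℤ) : 1 ≤ modeWeight L p :=
  Real.one_le_sqrt.2 (by nlinarith [sq_nonneg (2 * Real.pi * p / L)])

lemma modeWeight_pos (L : ℝ) (p : ℤ) : 0 < modeWeight L p :=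
  one_pos.trans_le (one_le_modeWeight L p)

lemma rpow_eq_modeWeight (L s : ℝ) (p : ℤ) :
    (1 + (2 * Real.pi * p / L) ^ 2) ^ s = modeWeight L p ^ (2 * s) := by
  rw [modeWeight, Real.sqrt_eq_rpow, ← Real.rpow_mul (by positivity)]
  congr 1; ring

lemma abs_freq_le_modeWeight (L : ℝ) (p : ℤ) : |2 * Real.pi * p / L| ≤ modeWeight L p :=
  Real.abs_le_sqrt (by linarith)

/-- Together with `abs_le_modeWeight`, this translates between the scale `|p|` of the cut-offs and
the weight of the Sobolev norms. -/
lemma modeWeight_le {L : ℝ} (hL : 0 < L) (p : ℤ) :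
    modeWeight L p ≤ 1 + 2 * Real.pi / L * |(p : ℝ)| := by
  have h : 0 ≤ 2 * Real.pi / L * |(p : ℝ)| := by positivity
  refine Real.sqrt_le_iff.2 ⟨by positivity, ?_⟩
  have e : (2 * Real.pi * p / L) ^ 2 = (2 * Real.pi / L * |(p : ℝ)|) ^ 2 := by
    rw [mul_pow, sq_abs]; ring
  rw [e]; nlinarith

lemma abs_le_modeWeight {L : ℝ} (hL : 0 < L) (p : ℤ) :
    |(p : ℝ)| ≤ L / (2 * Real.pi) * modeWeight L p := by
  have h := abs_freq_le_modeWeight L p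
  rw [abs_div, abs_mul, abs_of_pos hL, abs_of_pos Real.two_pi_pos, div_le_iff₀ hL] at h
  rw [div_mul_eq_mul_div, le_div_iff₀ Real.two_pi_pos]
  linarith

lemma summable_modeWeight {L : ℝ} (hL : 0 < L) {e : ℝ} (he : e < -1) :
    Summable fun p : ℤ => modeWeight L p ^ e := by
  have hc : 0 < 2 * Real.pi / L := by positivity
  have h := (Real.summable_abs_int_rpow (b := -e) (by linarith)).mul_left ((2 * Real.pi / L) ^ e)
  rw [neg_neg] at h
  refine Summable.of_norm_bounded_eventually h ?_
  -- The comparison with `|p|^e` is made away from `p = 0`; the negative exponent reverses `|2πp/L|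
  -- ≤ ⟨p⟩`.
  filter_upwards [(Set.finite_singleton (0 : ℤ)).compl_mem_cofinite] with p hp
  have hp' : (0 : ℝ) < |(p : ℝ)| := abs_pos.2 (by exact_mod_cast hp)
  rw [Real.norm_of_nonneg (Real.rpow_nonneg (modeWeight_pos L p).le _),
    ← Real.mul_rpow hc.le hp'.le]
  refine Real.rpow_le_rpow_of_nonpos (by positivity) ?_ (by linarith)
  have := abs_freq_le_modeWeight L p
  rwa [mul_div_right_comm, abs_mul, abs_of_pos hc] at this

/-! ### Fourier coefficients, Sobolev norms and Parseval on a circle. -/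

section Fourier

variable {L : ℝ} {η : ℝ → ℂ}

/-- Integration by parts; the boundary terms cancel by periodicity. -/
lemma fourierMode_deriv (hL : 0 < L) (hη : ContDiff ℝ ∞ η) (hper : Function.Periodic η L) (p : ℤ) :
    fourierMode L (deriv η) p =
      ((2 * Real.pi * p / L : ℝ) * Complex.I) * fourierMode L η p := by
  have hu : ∀ t : ℝ, HasDerivAt
      (fun t : ℝ => Complex.exp (-(2 * Real.pi * p * t / L : ℝ) * Complex.I))
      (-((2 * Real.pi * p / L : ℝ) * Complex.I) *
        Complex.exp (-(2 * Real.pi * p * t / L : ℝ) * Complex.I)) t := by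
    intro t
    have h1 : HasDerivAt (fun t : ℝ => (t : ℂ)) 1 t := Complex.ofRealCLM.hasDerivAt
    have h2 := (h1.const_mul (-((2 * Real.pi * p / L : ℝ) * Complex.I))).cexp
    convert h2 using 1
    · ext s; congr 1; push_cast; ring
    · rw [mul_comm, mul_one]; congr 2; push_cast; ring
  have hv : ∀ t, HasDerivAt η (deriv η t) t := fun t =>
    (hη.differentiable (by simp) t).hasDerivAt
  have hc : Continuous (deriv η) := hη.continuous_deriv (by simp)
  have key := intervalIntegral.integral_mul_deriv_eq_deriv_mul (a := 0) (b := L)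
    (fun t _ => hu t) (fun t _ => hv t)
    (Continuous.intervalIntegrable (by fun_prop) _ _) (hc.intervalIntegrable _ _)
  have hLc : (L : ℂ) ≠ 0 := by exact_mod_cast hL.ne'
  have hexp : Complex.exp (-(2 * Real.pi * p * L / L : ℝ) * Complex.I) = 1 := by
    rw [Complex.exp_eq_one_iff]
    refine ⟨-p, ?_⟩
    push_cast
    field_simp
  have hexp0 : Complex.exp (-(2 * Real.pi * p * 0 / L : ℝ) * Complex.I) = 1 := by simp
  have hp0 : η L = η 0 := by simpa using hper 0
  simp only [fourierMode]
  rw [key, hexp, hexp0, hp0, sub_self, zero_sub]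
  simp_rw [mul_assoc (-((2 * Real.pi * p / L : ℝ) * Complex.I)) _ _]
  rw [intervalIntegral.integral_const_mul]
  ring

lemma periodic_deriv (hper : Function.Periodic η L) : Function.Periodic (deriv η) L := by
  intro t
  rw [← deriv_comp_add_const]
  congr 1
  ext s; exact hper s

lemma contDiff_periodic_iteratedDeriv (hη : ContDiff ℝ ∞ η) (hper : Function.Periodic η L) (n : ℕ) :
    ContDiff ℝ ∞ (iteratedDeriv n η) ∧ Function.Periodic (iteratedDeriv n η) L := by
  induction n with
  | zero => simpa using ⟨hη, hper⟩
  | succ n ih =>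
    rw [iteratedDeriv_succ]
    exact ⟨(contDiff_infty_iff_deriv.1 ih.1).2, periodic_deriv ih.2⟩

lemma norm_fourierMode_iteratedDeriv (hL : 0 < L) (hη : ContDiff ℝ ∞ η)
    (hper : Function.Periodic η L) (n : ℕ) (p : ℤ) :
    ‖fourierMode L (iteratedDeriv n η) p‖ =
      |2 * Real.pi * p / L| ^ n * ‖fourierMode L η p‖ := by
  induction n with
  | zero => simp
  | succ n ih =>
    obtain ⟨h1, h2⟩ := contDiff_periodic_iteratedDeriv hη hper n
    rw [iteratedDeriv_succ, fourierMode_deriv hL h1 h2, norm_mul, ih, norm_mul, Complex.norm_I,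
      Complex.norm_real, Real.norm_eq_abs]
    ring

lemma norm_fourierMode_iteratedDeriv_le (hL : 0 < L) (hη : ContDiff ℝ ∞ η)
    (hper : Function.Periodic η L) (n : ℕ) (p : ℤ) :
    ‖fourierMode L (iteratedDeriv n η) p‖ ≤ modeWeight L p ^ n * ‖fourierMode L η p‖ := by
  rw [norm_fourierMode_iteratedDeriv hL hη hper]
  gcongr
  exact abs_freq_le_modeWeight L p

lemma exists_norm_fourierMode_le (hL : 0 < L) (hη : Continuous η) :
    ∃ M, ∀ p, ‖fourierMode L η p‖ ≤ M := by
  obtain ⟨M, hM⟩ := (isCompact_Icc (a := 0) (b := L)).exists_bound_of_continuousOn hη.continuousOn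
  refine ⟨M, fun p => ?_⟩
  have h := intervalIntegral.norm_integral_le_of_norm_le_const (a := 0) (b := L) (C := M)
    (f := fun t => Complex.exp (-(2 * Real.pi * p * t / L : ℝ) * Complex.I) * η t) (by
      intro t ht
      rw [uIoc_of_le hL.le] at ht
      rw [norm_mul, ← Complex.ofReal_neg, Complex.norm_exp_ofReal_mul_I, one_mul]
      exact hM t ⟨ht.1.le, ht.2⟩)
  rw [fourierMode, norm_mul, norm_div, norm_one, Complex.norm_real, Real.norm_of_nonneg hL.le]
  rw [sub_zero, abs_of_pos hL] at h
  calc 1 / L * _ ≤ 1 / L * (M * L) := by gcongr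
    _ = M := by field_simp

/-- The Fourier coefficients of a smooth periodic function decay rapidly. -/
lemma exists_norm_fourierMode_le_rpow (hL : 0 < L) (hη : ContDiff ℝ ∞ η)
    (hper : Function.Periodic η L) (N : ℕ) :
    ∃ M, 0 ≤ M ∧ ∀ p, ‖fourierMode L η p‖ ≤ M * modeWeight L p ^ (-(N : ℝ)) := by
  obtain ⟨M0, hM0⟩ := exists_norm_fourierMode_le hL hη.continuous
  obtain ⟨M, hM⟩ := exists_norm_fourierMode_le hL (contDiff_periodic_iteratedDeriv hη hper N).1.continuous
  have h0 : 0 ≤ M0 := (norm_nonneg _).trans (hM0 0)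
  have h1 : 0 ≤ M := (norm_nonneg _).trans (hM 0)
  refine ⟨2 ^ N * (M0 + M), by positivity, fun p => ?_⟩
  have hJ := modeWeight_pos L p
  rw [Real.rpow_neg hJ.le, Real.rpow_natCast, ← div_eq_mul_inv, le_div_iff₀ (by positivity)]
  have hb := hM p
  rw [norm_fourierMode_iteratedDeriv hL hη hper] at hb
  set a := |2 * Real.pi * p / L| with ha
  have ha0 : 0 ≤ a := abs_nonneg _
  -- Low frequencies (`a ≤ 1`) are controlled by the bound `M0` for `η`, high ones by the bound `M`
  -- for its `N`-th derivative.
  have hJa : modeWeight L p ≤ 2 * max 1 a := by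
    have := modeWeight_le hL p
    have e : 2 * Real.pi / L * |(p : ℝ)| = a := by
      rw [ha, abs_div, abs_mul, abs_of_pos hL, abs_of_pos Real.two_pi_pos]; ring
    rw [e] at this
    linarith [le_max_left 1 a, le_max_right 1 a]
  calc ‖fourierMode L η p‖ * modeWeight L p ^ N
      ≤ ‖fourierMode L η p‖ * (2 * max 1 a) ^ N := by gcongr
    _ = 2 ^ N * (‖fourierMode L η p‖ * max 1 a ^ N) := by rw [mul_pow]; ring
    _ ≤ _ := by
      gcongr
      rcases le_total 1 a with h | h
      · rw [max_eq_right h]; linarith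
      · rw [max_eq_left h, one_pow, mul_one]; linarith [hM0 p]

/-- The square of the `L^{s,2}`-norm of a function on a circle of length `L`, up to the
factor `L`. -/
def sobolevSq (L s : ℝ) (η : ℝ → ℂ) : ℝ≥0∞ :=
  ∑' p : ℤ, ENNReal.ofReal ((1 + (2 * Real.pi * p / L) ^ 2) ^ s) * ‖fourierMode L η p‖ₑ ^ 2

lemma sobolevSq_term (L s : ℝ) (η : ℝ → ℂ) (p : ℤ) :
    ENNReal.ofReal ((1 + (2 * Real.pi * p / L) ^ 2) ^ s) * ‖fourierMode L η p‖ₑ ^ 2 =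
      ENNReal.ofReal (modeWeight L p ^ (2 * s) * ‖fourierMode L η p‖ ^ 2) := by
  rw [rpow_eq_modeWeight, ENNReal.ofReal_mul (Real.rpow_nonneg (modeWeight_pos L p).le _),
    ENNReal.ofReal_pow (norm_nonneg _), ofReal_norm]

/-- Rapid decay beats any weight. Finiteness lets this quantity be pulled out of integrals whose
integrands are not known to be measurable. -/
lemma sobolevSq_ne_top (hL : 0 < L) (s : ℝ) (hη : ContDiff ℝ ∞ η) (hper : Function.Periodic η L) :
    sobolevSq L s η ≠ ⊤ := by
  obtain ⟨N, hN⟩ := exists_nat_gt (s + 1)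
  obtain ⟨M, hM0, hM⟩ := exists_norm_fourierMode_le_rpow hL hη hper N
  have hs : Summable fun p : ℤ => M ^ 2 * modeWeight L p ^ (2 * s - 2 * N) :=
    (summable_modeWeight hL (by linarith)).mul_left _
  refine ne_top_of_le_ne_top hs.tsum_ofReal_ne_top ?_
  refine ENNReal.tsum_le_tsum fun p => ?_
  rw [sobolevSq_term]
  refine ENNReal.ofReal_le_ofReal ?_
  have hJ := modeWeight_pos L p
  calc modeWeight L p ^ (2 * s) * ‖fourierMode L η p‖ ^ 2
      ≤ modeWeight L p ^ (2 * s) * (M * modeWeight L p ^ (-(N : ℝ))) ^ 2 := by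
        gcongr; exact hM p
    _ = M ^ 2 * modeWeight L p ^ (2 * s - 2 * N) := by
        rw [mul_pow, ← Real.rpow_mul_natCast hJ.le, mul_left_comm, ← Real.rpow_add hJ]
        congr 2; push_cast; ring

lemma integral_exp_mul_conj_exp (hL : 0 < L) (p q : ℤ) :
    ∫ t in (0 : ℝ)..L, Complex.exp ((2 * Real.pi * p * t / L : ℝ) * Complex.I) *
      (starRingEnd ℂ) (Complex.exp ((2 * Real.pi * q * t / L : ℝ) * Complex.I)) =
        if p = q then (L : ℂ) else 0 := by
  have hLc : (L : ℂ) ≠ 0 := by exact_mod_cast hL.ne'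
  have e : ∀ t : ℝ, Complex.exp ((2 * Real.pi * p * t / L : ℝ) * Complex.I) *
      (starRingEnd ℂ) (Complex.exp ((2 * Real.pi * q * t / L : ℝ) * Complex.I)) =
      Complex.exp ((2 * Real.pi * (p - q) / L * Complex.I) * t) := by
    intro t
    rw [← Complex.exp_conj, ← Complex.exp_add]
    congr 1
    rw [map_mul, Complex.conj_I, Complex.conj_ofReal]
    push_cast; ring
  simp_rw [e]
  split_ifs with h
  · subst h; simp
  · have hpq : (p : ℂ) - q ≠ 0 := sub_ne_zero.2 (by exact_mod_cast h)
    rw [integral_exp_mul_complex (by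
      simp [hpq, hLc, Real.pi_ne_zero])]
    have : Complex.exp ((2 * Real.pi * (p - q) / L * Complex.I) * L) = 1 := by
      rw [Complex.exp_eq_one_iff]
      refine ⟨p - q, ?_⟩
      push_cast
      field_simp
    rw [this]; simp

/-- Parseval's identity for trigonometric polynomials. -/
lemma lintegral_trig_poly (hL : 0 < L) (S : Finset ℤ) (a : ℤ → ℂ) :
    ∫⁻ t in Ioc 0 L, ‖∑ p ∈ S, a p *
      Complex.exp ((2 * Real.pi * p * t / L : ℝ) * Complex.I)‖ₑ ^ 2 =
        ENNReal.ofReal L * ∑ p ∈ S, ‖a p‖ₑ ^ 2 := by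
  have hcont : Continuous fun t : ℝ => ∑ p ∈ S, a p *
      Complex.exp ((2 * Real.pi * p * t / L : ℝ) * Complex.I) := by fun_prop
  set F := fun t : ℝ => ∑ p ∈ S, a p *
      Complex.exp ((2 * Real.pi * p * t / L : ℝ) * Complex.I) with hF
  have hreal : ∫ t in (0 : ℝ)..L, ‖F t‖ ^ 2 = L * ∑ p ∈ S, ‖a p‖ ^ 2 := by
    -- Over `ℂ`, the square `‖F‖² = F · conj F` expands into a double sum whose off-diagonal terms
    -- integrate to zero.
    have hc : ((∫ t in (0 : ℝ)..L, ‖F t‖ ^ 2 : ℝ) : ℂ) = ((L * ∑ p ∈ S, ‖a p‖ ^ 2 : ℝ) : ℂ) := by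
      rw [← intervalIntegral.integral_ofReal]
      have e : ∀ t : ℝ, ((‖F t‖ ^ 2 : ℝ) : ℂ) = ∑ p ∈ S, ∑ q ∈ S,
          (a p * (starRingEnd ℂ) (a q)) *
          (Complex.exp ((2 * Real.pi * p * t / L : ℝ) * Complex.I) *
          (starRingEnd ℂ) (Complex.exp ((2 * Real.pi * q * t / L : ℝ) * Complex.I))) := by
        intro t
        rw [Complex.ofReal_pow, ← Complex.mul_conj', hF]
        simp only [map_sum, map_mul, Finset.sum_mul_sum]
        refine Finset.sum_congr rfl fun p _ => Finset.sum_congr rfl fun q _ => by ring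
      simp_rw [e]
      rw [intervalIntegral.integral_finsetSum]
      swap
      · intro p _
        refine Continuous.intervalIntegrable ?_ _ _
        fun_prop
      have : ∀ p ∈ S, (∫ t in (0 : ℝ)..L, ∑ q ∈ S,
          (a p * (starRingEnd ℂ) (a q)) *
          (Complex.exp ((2 * Real.pi * p * t / L : ℝ) * Complex.I) *
          (starRingEnd ℂ) (Complex.exp ((2 * Real.pi * q * t / L : ℝ) * Complex.I)))) =
          L * ((‖a p‖ ^ 2 : ℝ) : ℂ) := by
        intro p hp
        rw [intervalIntegral.integral_finsetSum]
        swap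
        · intro q _
          refine Continuous.intervalIntegrable ?_ _ _
          fun_prop
        simp_rw [intervalIntegral.integral_const_mul, integral_exp_mul_conj_exp hL]
        rw [Complex.ofReal_pow, ← Complex.mul_conj']
        simp [hp, mul_comm]
      rw [Finset.sum_congr rfl this]
      push_cast
      rw [Finset.mul_sum]
    exact_mod_cast hc
  have h2 : ∀ t, ‖F t‖ₑ ^ 2 = ENNReal.ofReal (‖F t‖ ^ 2) := fun t => by
    rw [ENNReal.ofReal_pow (norm_nonneg _), ofReal_norm]
  change ∫⁻ t in Ioc 0 L, ‖F t‖ₑ ^ 2 = _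
  simp_rw [h2]
  rw [← ofReal_integral_eq_lintegral_ofReal, ← intervalIntegral.integral_of_le hL.le, hreal,
    ENNReal.ofReal_mul hL.le, ENNReal.ofReal_sum_of_nonneg (fun _ _ => by positivity)]
  · congr 1
    refine Finset.sum_congr rfl fun p _ => ?_
    rw [ENNReal.ofReal_pow (norm_nonneg _), ofReal_norm]
  · exact ((hcont.norm.pow 2).integrableOn_Icc (a := 0) (b := L)).mono_set Ioc_subset_Icc_self
  · exact Filter.Eventually.of_forall fun t => by positivity

end Fourier

end ModeDeformation

namespace ModeDeformation

/-! ### Size and support of the derivatives of the cut-offs. -/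

lemma contDiff_radial {χ : ℝ → ℝ} (hχ : ContDiff ℝ ∞ χ) {a : ℝ} (ha : 0 < a)
    (h1 : ∀ r ≤ a, χ r = 1) : ContDiff ℝ ∞ fun z : ℂ => χ ‖z‖ := by
  refine contDiff_iff_contDiffAt.2 fun z => ?_
  -- The norm is not smooth at the origin, but `χ` is constant there.
  by_cases hz : z = 0
  · subst hz
    refine (contDiffAt_const (c := (1 : ℝ))).congr_of_eventuallyEq ?_
    filter_upwards [Metric.ball_mem_nhds (0 : ℂ) ha] with y hy
    exact h1 _ (by simpa using (mem_ball_zero_iff.1 hy).le)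
  · exact hχ.contDiffAt.comp z (contDiffAt_norm ℝ hz)

lemma exists_norm_iteratedFDeriv_radial_le {χ : ℝ → ℝ} (hχ : ContDiff ℝ ∞ χ) {a b : ℝ}
    (ha : 0 < a) (h1 : ∀ r ≤ a, χ r = 1) (h0 : ∀ r, b ≤ r → χ r = 0) (i : ℕ) :
    ∃ C, ∀ z : ℂ, ‖iteratedFDeriv ℝ i (fun z : ℂ => χ ‖z‖) z‖ ≤ C := by
  have hs : HasCompactSupport fun z : ℂ => χ ‖z‖ :=
    HasCompactSupport.intro (isCompact_closedBall 0 b) fun z hz => by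
      refine h0 _ ?_
      rw [mem_closedBall_zero_iff] at hz
      exact (not_le.1 hz).le
  exact ((contDiff_radial hχ ha h1).continuous_iteratedFDeriv
    (mod_cast le_top)).bounded_above_of_compact_support (hs.iteratedFDeriv i)

lemma norm_dir_le (a : Fin 3) : ‖dir a‖ ≤ 1 := by
  fin_cases a <;> simp [dir, Prod.norm_def]

/-- The chain rule gives one factor `s` per derivative; with `s = |p|` this is where the powers of
`|p|` in the derivatives of `χ_p` come from. -/
lemma norm_iteratedFDeriv_comp_smul_snd_le {F : ℂ → ℝ} (hF : ContDiff ℝ ∞ F) {i : ℕ} {C : ℝ}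
    (hC : ∀ z, ‖iteratedFDeriv ℝ i F z‖ ≤ C) {s : ℝ} (w : ℝ × ℂ) :
    ‖iteratedFDeriv ℝ i (fun w : ℝ × ℂ => F (s • w.2)) w‖ ≤ C * |s| ^ i := by
  have e : (fun w : ℝ × ℂ => F (s • w.2)) = F ∘ (s • ContinuousLinearMap.snd ℝ ℝ ℂ) := rfl
  rw [e, ContinuousLinearMap.iteratedFDeriv_comp_right _ hF _ (mod_cast le_top)]
  refine (ContinuousMultilinearMap.norm_compContinuousLinearMap_le _ _).trans ?_
  rw [Finset.prod_const, Finset.card_fin]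
  have hn : ‖s • ContinuousLinearMap.snd ℝ ℝ ℂ‖ ≤ |s| := by
    rw [norm_smul, Real.norm_eq_abs]
    exact mul_le_of_le_one_right (abs_nonneg _) (ContinuousLinearMap.norm_snd_le ℝ ℝ ℂ)
  have hC0 : 0 ≤ C := (norm_nonneg _).trans (hC 0)
  gcongr
  exact hC _

namespace CutOffs

variable {r₀ : ℝ} (c : CutOffs r₀)

lemma mode_eq (p : ℤ) : c.mode p = fun w : ℝ × ℂ =>
    (fun z : ℂ => c.χ ‖z‖) (|(p : ℝ)| • w.2) * (fun z : ℂ => c.χ₀ ‖z‖) ((1 : ℝ) • w.2) := by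
  ext w
  simp [mode]

/-- Leibniz rule: `i` derivatives on `χ(|p| r)` give `|p|^i`, and those on the fixed cut-off `χ₀`
are bounded. The weight `1 + |p|` absorbs all `i ≤ m`, also at `p = 0`. -/
lemma exists_norm_iteratedFDeriv_mode_le (hr : 0 < r₀) (m : ℕ) :
    ∃ C, 0 ≤ C ∧ ∀ p w, ‖iteratedFDeriv ℝ m (c.mode p) w‖ ≤ C * (1 + |(p : ℝ)|) ^ m := by
  choose A hA using exists_norm_iteratedFDeriv_radial_le c.χ_smooth c.R₀_pos c.χ_one c.χ_zero
  choose B hB using exists_norm_iteratedFDeriv_radial_le c.χ₀_smooth (half_pos hr) c.χ₀_one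
    c.χ₀_zero
  have hA0 : ∀ i, 0 ≤ A i := fun i => (norm_nonneg _).trans (hA i 0)
  have hB0 : ∀ i, 0 ≤ B i := fun i => (norm_nonneg _).trans (hB i 0)
  refine ⟨∑ i ∈ Finset.range (m + 1), (m.choose i : ℝ) * A i * B (m - i),
    Finset.sum_nonneg fun i _ => by
      have := hA0 i
      have := hB0 (m - i)
      positivity, fun p w => ?_⟩
  have hX := contDiff_radial c.χ_smooth c.R₀_pos c.χ_one
  have hX₀ := contDiff_radial c.χ₀_smooth (half_pos hr) c.χ₀_one
  rw [mode_eq]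
  refine (norm_iteratedFDeriv_mul_le (N := ∞)
    (f := fun w : ℝ × ℂ => (fun z : ℂ => c.χ ‖z‖) (|(p : ℝ)| • w.2))
    (g := fun w : ℝ × ℂ => (fun z : ℂ => c.χ₀ ‖z‖) ((1 : ℝ) • w.2))
    (hX.comp (contDiff_snd.const_smul _))
    (hX₀.comp (contDiff_snd.const_smul _)) w (mod_cast le_top)).trans ?_
  rw [Finset.sum_mul]
  refine Finset.sum_le_sum fun i hi => ?_
  have h1 := norm_iteratedFDeriv_comp_smul_snd_le hX (hA i) (s := |(p : ℝ)|) w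
  have h2 := norm_iteratedFDeriv_comp_smul_snd_le hX₀ (hB (m - i)) (s := 1) w
  rw [abs_abs] at h1
  rw [abs_one, one_pow, mul_one] at h2
  have h3 : |(p : ℝ)| ^ i ≤ (1 + |(p : ℝ)|) ^ m :=
    (pow_le_pow_left₀ (abs_nonneg _) (by linarith) i).trans
      (pow_le_pow_right₀ (by linarith [abs_nonneg (p : ℝ)]) (by
        have := Finset.mem_range.1 hi; omega))
  calc _ ≤ (m.choose i : ℝ) * (A i * |(p : ℝ)| ^ i) * B (m - i) := by
        have := hA0 i
        have := hB0 (m - i)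
        gcongr
    _ = ((m.choose i : ℝ) * A i * B (m - i)) * |(p : ℝ)| ^ i := by ring
    _ ≤ _ := by
        have := hA0 i
        have := hB0 (m - i)
        gcongr

lemma abs_modeDeriv_le {m : ℕ} (μ : Fin m → Fin 3) (p : ℤ) (w : ℝ × ℂ) :
    |c.modeDeriv μ p w| ≤ ‖iteratedFDeriv ℝ m (c.mode p) w‖ := by
  rw [modeDeriv]
  simpa using ContinuousMultilinearMap.le_opNorm_mul_prod_of_le (iteratedFDeriv ℝ m (c.mode p) w)
    (m := fun i => dir (μ i)) (b := fun _ => 1) fun i => norm_dir_le _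

/-- The strict inequality is an open condition, so `χ_p` vanishes near `w` and so do its derivatives
there. -/
lemma modeDeriv_eq_zero_of_lt {m : ℕ} (μ : Fin m → Fin 3) {p : ℤ} {w : ℝ × ℂ}
    (h : 2 * c.R₀ < |(p : ℝ)| * ‖w.2‖) : c.modeDeriv μ p w = 0 := by
  have : c.mode p =ᶠ[nhds w] 0 := by
    have hc : Continuous fun w : ℝ × ℂ => |(p : ℝ)| * ‖w.2‖ := by fun_prop
    filter_upwards [hc.continuousAt.eventually_const_lt h] with y hy
    rw [mode, c.χ_zero _ hy.le, zero_mul]; rfl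
  rw [modeDeriv, (this.iteratedFDeriv ℝ m).eq_of_nhds]
  simp

lemma modeDeriv_eq_zero_of_small {m : ℕ} (hm : 0 < m) (μ : Fin m → Fin 3) {p : ℤ} {w : ℝ × ℂ}
    (h : |(p : ℝ)| * ‖w.2‖ < c.R₀) (h' : ‖w.2‖ < r₀ / 2) : c.modeDeriv μ p w = 0 := by
  have : c.mode p =ᶠ[nhds w] fun _ => 1 := by
    have hc : Continuous fun w : ℝ × ℂ => |(p : ℝ)| * ‖w.2‖ := by fun_prop
    have hc' : Continuous fun w : ℝ × ℂ => ‖w.2‖ := by fun_prop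
    filter_upwards [hc.continuousAt.eventually_lt_const h,
      hc'.continuousAt.eventually_lt_const h'] with y hy hy'
    rw [mode, c.χ_one _ hy.le, c.χ₀_one _ hy'.le, one_mul]
  rw [modeDeriv, (this.iteratedFDeriv ℝ m).eq_of_nhds, iteratedFDeriv_const_of_ne hm.ne']
  rfl

/-- `χ_p` is invariant under translation in `t`. Hence the multipliers act as constant coefficients
at fixed `z`, as Parseval requires. -/
lemma modeDeriv_fst {m : ℕ} (μ : Fin m → Fin 3) (p : ℤ) (t : ℝ) (z : ℂ) :
    c.modeDeriv μ p (t, z) = c.modeDeriv μ p (0, z) := by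
  have h := iteratedFDeriv_comp_add_right (𝕜 := ℝ) (f := c.mode p) m (t, (0 : ℂ)) (0, z)
  have e : (fun w : ℝ × ℂ => c.mode p (w + (t, 0))) = c.mode p := by
    ext w; simp [mode]
  rw [e] at h
  rw [modeDeriv, modeDeriv, h]
  simp

/-- A derivative of order `m` of `χ_p` is of size `⟨p⟩^m`, and it is supported where
`r ≲ ⟨p⟩⁻¹`; if `m ≥ 1`, it is supported where `r ∼ ⟨p⟩⁻¹`. -/
lemma exists_modeDeriv_bounds (hr : 0 < r₀) {L : ℝ} (hL : 0 < L) {m : ℕ} (μ : Fin m → Fin 3) :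
    ∃ C a b : ℝ, 0 < C ∧ 0 < a ∧ 0 < b ∧ ∀ p w, |c.modeDeriv μ p w| ≤ C * modeWeight L p ^ m ∧
      (w ∈ punctured r₀ → c.modeDeriv μ p w ≠ 0 →
        modeWeight L p * ‖w.2‖ ≤ b ∧ (m ≠ 0 → a ≤ modeWeight L p * ‖w.2‖)) := by
  obtain ⟨C, hC0, hC⟩ := c.exists_norm_iteratedFDeriv_mode_le hr m
  have hR := c.R₀_pos
  -- On the support, `|p| r ≤ 2 R₀` and `r < r₀`, which yields the upper end through `⟨p⟩ ≤ 1 +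
  -- (2π/L)|p|`. If `m ≥ 1`, also `|p| r ≥ R₀` or `r ≥ r₀ / 2`, which yields the lower end. The
  -- summand `1` only makes the first constant positive.
  refine ⟨C * (1 + L / (2 * Real.pi)) ^ m + 1, min (2 * Real.pi / L * c.R₀) (r₀ / 2),
    r₀ + 2 * Real.pi / L * (2 * c.R₀), by positivity, by positivity, by positivity,
    fun p w => ⟨?_, fun hw hne => ⟨?_, fun hm => ?_⟩⟩⟩
  · have hJ := one_le_modeWeight L p
    refine (c.abs_modeDeriv_le μ p w).trans ((hC p w).trans ?_)
    have : 1 + |(p : ℝ)| ≤ (1 + L / (2 * Real.pi)) * modeWeight L p := by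
      linarith [abs_le_modeWeight hL p]
    calc C * (1 + |(p : ℝ)|) ^ m ≤ C * ((1 + L / (2 * Real.pi)) * modeWeight L p) ^ m := by gcongr
      _ = C * (1 + L / (2 * Real.pi)) ^ m * modeWeight L p ^ m := by rw [mul_pow, mul_assoc]
      _ ≤ _ := by gcongr; linarith
  · have h : |(p : ℝ)| * ‖w.2‖ ≤ 2 * c.R₀ := by
      by_contra h; exact hne (c.modeDeriv_eq_zero_of_lt μ (not_le.1 h))
    calc modeWeight L p * ‖w.2‖ ≤ (1 + 2 * Real.pi / L * |(p : ℝ)|) * ‖w.2‖ := by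
          gcongr; exact modeWeight_le hL p
      _ = ‖w.2‖ + 2 * Real.pi / L * (|(p : ℝ)| * ‖w.2‖) := by ring
      _ ≤ _ := by gcongr; exact hw.2.le
  · by_contra hlt
    rw [not_le, lt_min_iff] at hlt
    refine hne (c.modeDeriv_eq_zero_of_small (Nat.pos_of_ne_zero hm) μ ?_ ?_)
    · have h1 := mul_le_mul_of_nonneg_right (abs_le_modeWeight hL p) (norm_nonneg w.2)
      refine h1.trans_lt ?_
      rw [mul_assoc, div_mul_eq_mul_div, div_lt_iff₀ Real.two_pi_pos]
      have := hlt.1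
      rw [div_mul_eq_mul_div, lt_div_iff₀ hL] at this
      linarith
    · exact (le_mul_of_one_le_left (norm_nonneg _) (one_le_modeWeight L p)).trans_lt hlt.2

/-- Only finitely many modes contribute at a point outside of the core. -/
lemma exists_finset_modeDeriv {m : ℕ} (μ : Fin m → Fin 3) {z : ℂ} (hz : 0 < ‖z‖) :
    ∃ S : Finset ℤ, ∀ t, ∀ p ∉ S, c.modeDeriv μ p (t, z) = 0 := by
  obtain ⟨N, hN⟩ := exists_nat_gt (2 * c.R₀ / ‖z‖)
  refine ⟨Finset.Icc (-N : ℤ) N, fun t p hp => c.modeDeriv_eq_zero_of_lt μ ?_⟩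
  have h : (N : ℤ) < |p| := by
    by_contra h
    rw [not_lt, abs_le] at h
    exact hp (Finset.mem_Icc.2 h)
  have h' : (N : ℝ) < |(p : ℝ)| := by exact_mod_cast h
  rw [div_lt_iff₀ hz] at hN
  exact hN.trans_le (by gcongr)

lemma modeOp_eq_sum {m : ℕ} (μ : Fin m → Fin 3) {L : ℝ} (η : ℝ → ℂ) {z : ℂ} {S : Finset ℤ}
    (hS : ∀ t, ∀ p ∉ S, c.modeDeriv μ p (t, z) = 0) (t : ℝ) :
    modeOp L (c.modeDeriv μ) η (t, z) = ∑ p ∈ S, (c.modeDeriv μ p (0, z) * fourierMode L η p) *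
      Complex.exp ((2 * Real.pi * p * t / L : ℝ) * Complex.I) := by
  rw [modeOp, tsum_eq_sum (s := S) fun p hp => by rw [hS t p hp]; simp]
  exact Finset.sum_congr rfl fun p _ => by rw [modeDeriv_fst]

end CutOffs

end ModeDeformation

namespace ModeDeformation

/-! ### Integrals of powers of `r` over annuli, and slicing of the tube. -/

/-- The annulus, or punctured disk, of size `J⁻¹` that carries a derivative of order `m` of
`χ_p`. -/
def modeAnnulus (m : ℕ) (a b J : ℝ) : Set ℂ :=
  {z | 0 < ‖z‖ ∧ J * ‖z‖ ≤ b ∧ (m ≠ 0 → a ≤ J * ‖z‖)}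

lemma measurableSet_modeAnnulus (m : ℕ) (a b J : ℝ) : MeasurableSet (modeAnnulus m a b J) := by
  have h1 : Measurable fun z : ℂ => J * ‖z‖ := by fun_prop
  have h2 : Measurable fun z : ℂ => ‖z‖ := by fun_prop
  refine (measurableSet_lt measurable_const h2).inter
    ((measurableSet_le h1 measurable_const).inter ?_)
  change MeasurableSet {z : ℂ | m ≠ 0 → a ≤ J * ‖z‖}
  by_cases hm : m = 0
  · rw [show {z : ℂ | m ≠ 0 → a ≤ J * ‖z‖} = univ by simp [hm]]
    exact MeasurableSet.univ
  · rw [show {z : ℂ | m ≠ 0 → a ≤ J * ‖z‖} = {z | a ≤ J * ‖z‖} by simp [hm]]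
    exact measurableSet_le measurable_const h1

/-- For `m = 0` the region reaches the origin, and `δ > -1` is integrability of `r^(2δ) r dr`. For
`m ≥ 1` it stays at distance `a` from the origin, where the integrand is bounded for every `δ`. -/
lemma lintegral_rpow_modeAnnulus_one_ne_top {m : ℕ} {a b δ : ℝ} (ha : 0 < a)
    (hδ : m = 0 → -1 < δ) :
    ∫⁻ z in modeAnnulus m a b 1, ENNReal.ofReal (‖z‖ ^ (2 * δ)) ≠ ⊤ := by
  have hsub : modeAnnulus m a b 1 ⊆ Metric.ball 0 (b + 1) := fun z hz => by
    have := hz.2.1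
    rw [mem_ball_zero_iff]; linarith
  have hmeas : Measurable fun z : ℂ => ‖z‖ ^ (2 * δ) := by fun_prop
  have hint : IntegrableOn (fun z : ℂ => ‖z‖ ^ (2 * δ)) (modeAnnulus m a b 1) := by
    by_cases hm : m = 0
    · refine IntegrableOn.mono_set ?_ hsub
      refine integrableOn_ball_of_norm_le_rpow (C := 1) (α := -(2 * δ)) (by simp) ?_ ?_
        hmeas.aestronglyMeasurable
      · have := hδ hm
        rw [Complex.finrank_real_complex]; push_cast; linarith
      · refine Filter.Eventually.of_forall fun z => ?_
        rw [neg_neg, one_mul, Real.norm_of_nonneg (by positivity)]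
    · have hc : ContinuousOn (fun r : ℝ => r ^ (2 * δ)) (Icc a b) := fun r hr =>
        (Real.continuousAt_rpow_const r _ (Or.inl (ha.trans_le hr.1).ne')).continuousWithinAt
      obtain ⟨M, hM⟩ := isCompact_Icc.exists_bound_of_continuousOn hc
      refine Measure.integrableOn_of_bounded (M := M) ?_ hmeas.aestronglyMeasurable ?_
      · exact ((measure_mono hsub).trans_lt Metric.isBounded_ball.measure_lt_top).ne
      · refine (ae_restrict_iff' (measurableSet_modeAnnulus _ _ _ _)).2
          (Filter.Eventually.of_forall fun z hz => hM _ ⟨?_, ?_⟩)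
        · simpa using hz.2.2 hm
        · simpa using hz.2.1
  exact hint.lintegral_lt_top.ne

/-- Substitution `z ↦ J z`: the Jacobian contributes `J^(-2)` and the integrand `J^(-2δ)`. -/
lemma lintegral_rpow_modeAnnulus {m : ℕ} {a b δ J : ℝ} (hJ : 0 < J) :
    ∫⁻ z in modeAnnulus m a b J, ENNReal.ofReal (‖z‖ ^ (2 * δ)) =
      ENNReal.ofReal (J ^ (-2 - 2 * δ)) *
        ∫⁻ z in modeAnnulus m a b 1, ENNReal.ofReal (‖z‖ ^ (2 * δ)) := by
  have hmeas : Measurable fun z : ℂ => ENNReal.ofReal (‖z‖ ^ (2 * δ)) := by fun_prop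
  have hmap := Measure.map_addHaar_smul (volume : Measure ℂ) hJ.ne'
  have hpre : (fun z : ℂ => J • z) ⁻¹' modeAnnulus m a b 1 = modeAnnulus m a b J := by
    ext z
    simp +contextual [modeAnnulus, abs_of_pos hJ, hJ.ne', -Complex.real_smul, norm_smul]
  have key : ∫⁻ z in modeAnnulus m a b 1, ENNReal.ofReal (‖z‖ ^ (2 * δ))
      ∂(Measure.map (J • ·) (volume : Measure ℂ)) =
      ENNReal.ofReal (J ^ (2 * δ)) *
        ∫⁻ z in modeAnnulus m a b J, ENNReal.ofReal (‖z‖ ^ (2 * δ)) := by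
    rw [setLIntegral_map (measurableSet_modeAnnulus _ _ _ _) hmeas (measurable_const_smul J), hpre,
      ← lintegral_const_mul _ hmeas]
    refine lintegral_congr fun z => ?_
    rw [norm_smul, Real.norm_of_nonneg hJ.le, Real.mul_rpow hJ.le (norm_nonneg _),
      ENNReal.ofReal_mul (by positivity)]
  rw [hmap, Measure.restrict_smul, lintegral_smul_measure, smul_eq_mul,
    Complex.finrank_real_complex, abs_of_pos (by positivity)] at key
  have e : ENNReal.ofReal (J ^ (-2 - 2 * δ)) =
      ENNReal.ofReal (J ^ (-(2 * δ))) * ENNReal.ofReal (J ^ 2)⁻¹ := by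
    rw [← ENNReal.ofReal_mul (by positivity), ← Real.rpow_natCast, ← Real.rpow_neg hJ.le,
      ← Real.rpow_add hJ]
    congr 2; push_cast; ring
  rw [e, mul_assoc, key, ← mul_assoc, ← ENNReal.ofReal_mul (by positivity), ← Real.rpow_add hJ]
  simp

/-- The fundamental domain of the punctured tube `{0 < |z| < ρ}` over a circle of length `L`. -/
lemma fundamental_domain_eq (ρ L : ℝ) :
    {w : ℝ × ℂ | w ∈ punctured ρ ∧ w.1 ∈ Ioc 0 L} = Ioc 0 L ×ˢ {z : ℂ | 0 < ‖z‖ ∧ ‖z‖ < ρ} := by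
  ext w
  simp only [punctured, mem_ofPred_eq, mem_prod]
  tauto

lemma measurableSet_fundamental_domain (ρ L : ℝ) :
    MeasurableSet {w : ℝ × ℂ | w ∈ punctured ρ ∧ w.1 ∈ Ioc 0 L} := by
  rw [fundamental_domain_eq]
  refine measurableSet_Ioc.prod ?_
  exact (measurableSet_lt measurable_const measurable_norm).inter
    (measurableSet_lt measurable_norm measurable_const)

/-- This half of Tonelli's theorem holds without measurability of `F`. The `t`-integral is
innermost, so that Parseval applies at fixed `z`. -/
lemma lintegral_fundamental_domain_le (ρ L : ℝ) (F : ℝ × ℂ → ℝ≥0∞) :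
    ∫⁻ w in {w : ℝ × ℂ | w ∈ punctured ρ ∧ w.1 ∈ Ioc 0 L}, F w ≤
      ∫⁻ z in {z : ℂ | 0 < ‖z‖ ∧ ‖z‖ < ρ}, ∫⁻ t in Ioc 0 L, F (t, z) := by
  rw [fundamental_domain_eq, Measure.volume_eq_prod, ← Measure.prod_restrict,
    ← lintegral_prod_swap]
  exact lintegral_prod_le _

variable {r₀ : ℝ} (c : CutOffs r₀)

/-! ### The two mode estimates on one component: integrated and pointwise. -/

lemma enorm_mul_sq_eq {x : ℝ} {y : ℂ} :
    ‖(x : ℂ) * y‖ₑ ^ 2 = ENNReal.ofReal (x ^ 2 * ‖y‖ ^ 2) := by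
  rw [← ofReal_norm, ← ENNReal.ofReal_pow (norm_nonneg _), norm_mul, Complex.norm_real, mul_pow,
    Real.norm_eq_abs, sq_abs]

/-- The `L²` estimate for `r^δ \underline{∂^m χ}[d_t^n η]` on one component of the tube. -/
lemma CutOffs.exists_lintegral_modeOp_le (hr : 0 < r₀) {L : ℝ} (hL : 0 < L) {m : ℕ}
    (μ : Fin m → Fin 3) (n : ℕ) {δ s : ℝ} (hδ : m = 0 → -1 < δ) (hs : (m : ℝ) + n - (1 + δ) ≤ s) :
    ∃ C : ℝ≥0, ∀ η : ℝ → ℂ, ContDiff ℝ ∞ η → Function.Periodic η L →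
      ∫⁻ w in {w : ℝ × ℂ | w ∈ punctured r₀ ∧ w.1 ∈ Ioc 0 L},
        ENNReal.ofReal (‖w.2‖ ^ (2 * δ)) *
          ‖modeOp L (c.modeDeriv μ) (iteratedDeriv n η) w‖ₑ ^ 2 ≤
        C * (ENNReal.ofReal L * sobolevSq L s η) := by
  obtain ⟨C, a, b, hC, ha, hb, hbd⟩ := c.exists_modeDeriv_bounds hr hL μ
  set I := ∫⁻ z in modeAnnulus m a b 1, ENNReal.ofReal (‖z‖ ^ (2 * δ)) with hI
  have hItop : I ≠ ⊤ := lintegral_rpow_modeAnnulus_one_ne_top ha hδ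
  refine ⟨(ENNReal.ofReal (C ^ 2) * I).toNNReal, fun η hη hper => ?_⟩
  rw [ENNReal.coe_toNNReal (ENNReal.mul_ne_top ENNReal.ofReal_ne_top hItop)]
  set D := {z : ℂ | 0 < ‖z‖ ∧ ‖z‖ < r₀}
  have hD : MeasurableSet D := (measurableSet_lt measurable_const measurable_norm).inter
    (measurableSet_lt measurable_norm measurable_const)
  -- The `p`-th summand of Parseval's identity, after integration in `t`.
  let A : ℤ → ℝ≥0∞ := fun p =>
    ENNReal.ofReal ((C * modeWeight L p ^ (m + n) * ‖fourierMode L η p‖) ^ 2)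
  let G : ℤ → ℂ → ℝ≥0∞ := fun p =>
    (modeAnnulus m a b (modeWeight L p)).indicator fun z => ENNReal.ofReal (‖z‖ ^ (2 * δ))
  have hGm : ∀ p, Measurable (G p) := fun p => Measurable.indicator (by fun_prop)
    (measurableSet_modeAnnulus _ _ _ _)
  -- Parseval over the finitely many modes alive at `z`; the indicator in `G p` records the support
  -- of the multiplier.
  have hstep : ∀ z ∈ D, ∫⁻ t in Ioc 0 L, ENNReal.ofReal (‖z‖ ^ (2 * δ)) *
      ‖modeOp L (c.modeDeriv μ) (iteratedDeriv n η) (t, z)‖ₑ ^ 2 ≤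
        ENNReal.ofReal L * ∑' p, A p * G p z := by
    intro z hz
    obtain ⟨S, hS⟩ := c.exists_finset_modeDeriv μ hz.1
    simp_rw [c.modeOp_eq_sum μ _ hS]
    rw [lintegral_const_mul' _ _ ENNReal.ofReal_ne_top, lintegral_trig_poly hL, mul_left_comm]
    gcongr
    rw [Finset.mul_sum]
    refine (Finset.sum_le_sum fun p _ => ?_).trans (ENNReal.sum_le_tsum S)
    by_cases h0 : c.modeDeriv μ p (0, z) = 0
    · simp [h0]
    · obtain ⟨h1, h2⟩ := (hbd p (0, z)).2 hz h0
      have hmem : z ∈ modeAnnulus m a b (modeWeight L p) := ⟨hz.1, h1, h2⟩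
      rw [enorm_mul_sq_eq, mul_comm]
      simp only [A, G, indicator_of_mem hmem]
      gcongr
      rw [← sq_abs, ← mul_pow]
      refine pow_le_pow_left₀ (by positivity) ?_ 2
      calc _ ≤ (C * modeWeight L p ^ m) * (modeWeight L p ^ n * ‖fourierMode L η p‖) := by
            have := modeWeight_pos L p
            exact mul_le_mul (hbd p (0, z)).1 (norm_fourierMode_iteratedDeriv_le hL hη hper n p)
              (norm_nonneg _) (by positivity)
        _ = _ := by ring
  calc _ ≤ ∫⁻ z in D, ∫⁻ t in Ioc 0 L, ENNReal.ofReal (‖z‖ ^ (2 * δ)) *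
        ‖modeOp L (c.modeDeriv μ) (iteratedDeriv n η) (t, z)‖ₑ ^ 2 :=
        lintegral_fundamental_domain_le _ _ _
    _ ≤ ∫⁻ z in D, ENNReal.ofReal L * ∑' p, A p * G p z := setLIntegral_mono' hD hstep
    _ ≤ ∫⁻ z, ENNReal.ofReal L * ∑' p, A p * G p z := setLIntegral_le_lintegral _ _
    _ = ENNReal.ofReal L * ∑' p, A p * (ENNReal.ofReal (modeWeight L p ^ (-2 - 2 * δ)) * I) := by
        rw [lintegral_const_mul' _ _ ENNReal.ofReal_ne_top,
          lintegral_tsum fun p => ((hGm p).const_mul _).aemeasurable]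
        congr 1
        refine tsum_congr fun p => ?_
        rw [lintegral_const_mul _ (hGm p), lintegral_indicator (measurableSet_modeAnnulus _ _ _ _),
          lintegral_rpow_modeAnnulus (modeWeight_pos L p)]
    _ ≤ ENNReal.ofReal L * ∑' p : ℤ, (ENNReal.ofReal (C ^ 2) * I) *
        (ENNReal.ofReal ((1 + (2 * Real.pi * p / L) ^ 2) ^ s) * ‖fourierMode L η p‖ₑ ^ 2) := by
        refine mul_le_mul_right (ENNReal.tsum_le_tsum fun p => ?_) _
        rw [sobolevSq_term, ← mul_assoc, mul_right_comm _ I]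
        refine mul_le_mul_left ?_ I
        simp only [A]
        have hJ := modeWeight_pos L p
        rw [← ENNReal.ofReal_mul (by positivity), ← ENNReal.ofReal_mul (by positivity)]
        refine ENNReal.ofReal_le_ofReal ?_
        -- The squared coefficient contributes `⟨p⟩^(2(m+n))` and the annulus `⟨p⟩^(-2-2δ)`; passing
        -- to the larger exponent `s` uses `⟨p⟩ ≥ 1`.
        calc _ = C ^ 2 * (modeWeight L p ^ (2 * ((m : ℝ) + n - (1 + δ))) *
              ‖fourierMode L η p‖ ^ 2) := by
              rw [show 2 * ((m : ℝ) + n - (1 + δ)) = ((2 * (m + n) : ℕ) : ℝ) + (-2 - 2 * δ) by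
                push_cast; ring, Real.rpow_add hJ, Real.rpow_natCast]
              ring
          _ ≤ _ := by
              gcongr
              exact one_le_modeWeight L p
    _ = _ := by rw [ENNReal.tsum_mul_left, mul_left_comm]; rfl

/-- The pointwise estimate for `r^δ \underline{∂^m χ}[d_t^n η]` on one component of the tube. -/
lemma CutOffs.exists_modeOp_le (hr : 0 < r₀) {L : ℝ} (hL : 0 < L) {m : ℕ}
    (μ : Fin m → Fin 3) (n : ℕ) {δ γ : ℝ} (hγ : 0 < γ) (hδ : m = 0 → 0 ≤ δ) :
    ∃ C : ℝ≥0, ∀ η : ℝ → ℂ, ContDiff ℝ ∞ η → Function.Periodic η L → ∀ w ∈ punctured r₀,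
      ENNReal.ofReal (‖w.2‖ ^ (2 * δ)) *
          ‖modeOp L (c.modeDeriv μ) (iteratedDeriv n η) w‖ₑ ^ 2 ≤
        C * (ENNReal.ofReal L * sobolevSq L ((m : ℝ) + n + γ - δ + 1 / 2) η) := by
  obtain ⟨C, a, b, hC, ha, hb, hbd⟩ := c.exists_modeDeriv_bounds hr hL μ
  set s := (m : ℝ) + n + γ - δ + 1 / 2 with hs
  set Z := ∑' p : ℤ, modeWeight L p ^ (-1 - 2 * γ) with hZ
  have hsum : Summable fun p : ℤ => modeWeight L p ^ (-1 - 2 * γ) :=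
    summable_modeWeight hL (by linarith)
  have hterm : ∀ p : ℤ, 0 ≤ modeWeight L p ^ (-1 - 2 * γ) := fun p =>
    Real.rpow_nonneg (modeWeight_pos L p).le _
  have hZ0 : 0 ≤ Z := tsum_nonneg hterm
  -- On the support of the `p`-th multiplier, `r^δ ≲ ⟨p⟩^(-δ)`.
  obtain ⟨B, hB0, hB⟩ : ∃ B : ℝ, 0 ≤ B ∧ ∀ x : ℝ, 0 < x → x ≤ b → (m ≠ 0 → a ≤ x) →
      x ^ δ ≤ B := by
    -- The sum covers both signs of `δ`: a negative `δ` forces `m ≠ 0`, and then `x ≥ a`.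
    refine ⟨a ^ δ + b ^ δ, by positivity, fun x hx hxb hxa => ?_⟩
    have h1 : 0 ≤ a ^ δ := by positivity
    have h2 : 0 ≤ b ^ δ := by positivity
    rcases le_or_gt 0 δ with h | h
    · linarith [Real.rpow_le_rpow hx.le hxb h]
    · have hm : m ≠ 0 := fun hm => absurd (hδ hm) (not_le.2 h)
      linarith [Real.rpow_le_rpow_of_nonpos ha (hxa hm) h.le]
  -- The division by `L` offsets the factor `L` in the Sobolev norm.
  refine ⟨Real.toNNReal ((B * C) ^ 2 * Z / L), fun η hη hper => ?_⟩
  rintro ⟨t, z⟩ hw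
  have hz : 0 < ‖z‖ := hw.1
  obtain ⟨S, hS⟩ := c.exists_finset_modeDeriv μ hz
  have hsup : ∀ p, ‖z‖ ^ δ * |c.modeDeriv μ p (0, z)| ≤
      B * C * modeWeight L p ^ ((m : ℝ) - δ) := by
    intro p
    have hJ := modeWeight_pos L p
    by_cases h0 : c.modeDeriv μ p (0, z) = 0
    · rw [h0, abs_zero, mul_zero]; positivity
    · obtain ⟨h1, h2⟩ := (hbd p (0, z)).2 hw h0
      have h3 := hB _ (mul_pos hJ hz) h1 h2
      have h4 : ‖z‖ ^ δ = modeWeight L p ^ (-δ) * (modeWeight L p * ‖z‖) ^ δ := by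
        rw [Real.mul_rpow hJ.le hz.le, ← mul_assoc, ← Real.rpow_add hJ]; simp
      calc _ ≤ modeWeight L p ^ (-δ) * B * (C * modeWeight L p ^ m) := by
            rw [h4]
            gcongr
            exact (hbd p (0, z)).1
        _ = _ := by
            rw [sub_eq_add_neg, Real.rpow_add hJ, Real.rpow_natCast]; ring
  set N := ‖modeOp L (c.modeDeriv μ) (iteratedDeriv n η) (t, z)‖ with hN
  -- The triangle inequality leaves `⟨p⟩^(m+n-δ)`, split as `⟨p⟩^(-1/2-γ) ⟨p⟩^s` so that the first
  -- factor is square summable.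
  have hNle : ‖z‖ ^ δ * N ≤ B * C * ∑ p ∈ S, modeWeight L p ^ (-(1 / 2) - γ) *
      (modeWeight L p ^ s * ‖fourierMode L η p‖) := by
    rw [hN, c.modeOp_eq_sum μ _ hS, Finset.mul_sum]
    refine (mul_le_mul_of_nonneg_left (norm_sum_le _ _) (by positivity)).trans ?_
    rw [Finset.mul_sum]
    refine Finset.sum_le_sum fun p _ => ?_
    have hJ := modeWeight_pos L p
    rw [norm_mul, norm_mul, Complex.norm_exp_ofReal_mul_I, mul_one, Complex.norm_real,
      Real.norm_eq_abs]
    calc _ = (‖z‖ ^ δ * |c.modeDeriv μ p (0, z)|) * ‖fourierMode L (iteratedDeriv n η) p‖ := by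
          ring
      _ ≤ (B * C * modeWeight L p ^ ((m : ℝ) - δ)) * (modeWeight L p ^ n * ‖fourierMode L η p‖) := by
          exact mul_le_mul (hsup p) (norm_fourierMode_iteratedDeriv_le hL hη hper n p)
            (norm_nonneg _) (by positivity)
      _ = B * C * (modeWeight L p ^ ((m : ℝ) - δ) * modeWeight L p ^ (n : ℝ) *
            ‖fourierMode L η p‖) := by rw [Real.rpow_natCast]; ring
      _ = B * C * (modeWeight L p ^ (-(1 / 2) - γ) * modeWeight L p ^ s *
            ‖fourierMode L η p‖) := by
          rw [← Real.rpow_add hJ, ← Real.rpow_add hJ]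
          congr 3; rw [hs]; ring
      _ = _ := by ring
  have hCS := Finset.sum_mul_sq_le_sq_mul_sq S (fun p => modeWeight L p ^ (-(1 / 2) - γ))
    (fun p => modeWeight L p ^ s * ‖fourierMode L η p‖)
  have hsq : (‖z‖ ^ δ * N) ^ 2 ≤ (B * C) ^ 2 * Z *
      ∑ p ∈ S, modeWeight L p ^ (2 * s) * ‖fourierMode L η p‖ ^ 2 := by
    have h1 : ∑ p ∈ S, (modeWeight L p ^ (-(1 / 2) - γ)) ^ 2 ≤ Z := by
      refine le_trans (le_of_eq (Finset.sum_congr rfl fun p _ => ?_))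
        (hsum.sum_le_tsum S fun p _ => hterm p)
      rw [← Real.rpow_mul_natCast (modeWeight_pos L p).le]
      congr 1; push_cast; ring
    have h2 : ∑ p ∈ S, (modeWeight L p ^ s * ‖fourierMode L η p‖) ^ 2 =
        ∑ p ∈ S, modeWeight L p ^ (2 * s) * ‖fourierMode L η p‖ ^ 2 := by
      refine Finset.sum_congr rfl fun p _ => ?_
      rw [mul_pow, ← Real.rpow_mul_natCast (modeWeight_pos L p).le]
      congr 2; push_cast; ring
    rw [h2] at hCS
    calc _ ≤ _ := pow_le_pow_left₀ (by positivity) hNle 2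
      _ = (B * C) ^ 2 * (∑ p ∈ S, modeWeight L p ^ (-(1 / 2) - γ) *
          (modeWeight L p ^ s * ‖fourierMode L η p‖)) ^ 2 := mul_pow _ _ _
      _ ≤ (B * C) ^ 2 * (Z * ∑ p ∈ S, modeWeight L p ^ (2 * s) * ‖fourierMode L η p‖ ^ 2) := by
          refine mul_le_mul_of_nonneg_left (hCS.trans ?_) (sq_nonneg _)
          refine mul_le_mul_of_nonneg_right h1 (Finset.sum_nonneg fun p _ => ?_)
          have := modeWeight_pos L p
          positivity
      _ = _ := by ring
  have hS0 : ∀ p ∈ S, 0 ≤ modeWeight L p ^ (2 * s) * ‖fourierMode L η p‖ ^ 2 := fun p _ => by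
    have := modeWeight_pos L p
    positivity
  calc ENNReal.ofReal (‖z‖ ^ (2 * δ)) * ‖modeOp L (c.modeDeriv μ) (iteratedDeriv n η) (t, z)‖ₑ ^ 2
      = ENNReal.ofReal ((‖z‖ ^ δ * N) ^ 2) := by
        rw [← ofReal_norm, ← ENNReal.ofReal_pow (norm_nonneg _),
          ← ENNReal.ofReal_mul (by positivity), mul_pow, ← Real.rpow_mul_natCast hz.le]
        congr 3; push_cast; ring_nf
    _ ≤ ENNReal.ofReal (((B * C) ^ 2 * Z / L) * (L *
          ∑ p ∈ S, modeWeight L p ^ (2 * s) * ‖fourierMode L η p‖ ^ 2)) := by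
        refine ENNReal.ofReal_le_ofReal (hsq.trans_eq ?_)
        field_simp
    _ = ENNReal.ofReal ((B * C) ^ 2 * Z / L) * (ENNReal.ofReal L * ∑ p ∈ S,
          ENNReal.ofReal (modeWeight L p ^ (2 * s) * ‖fourierMode L η p‖ ^ 2)) := by
        rw [ENNReal.ofReal_mul (by positivity), ENNReal.ofReal_mul hL.le,
          ENNReal.ofReal_sum_of_nonneg hS0]
    _ ≤ _ := by
        refine mul_le_mul_right (mul_le_mul_right ?_ _) _
        simp_rw [← sobolevSq_term]
        exact ENNReal.sum_le_tsum S

end ModeDeformation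

namespace ModeDeformation

/-! ### Bounds for the metric. -/

open Matrix in
-- Cauchy–Schwarz for the inner product `G⁻¹`, applied to `v` and `G e_b`: their product is `v b`,
-- and the square of `G e_b` is `G b b`.
lemma sq_le_mul_dotProduct_inv_mulVec {k : Type*} [Fintype k] [DecidableEq k] {G : Matrix k k ℝ}
    (hG : G.PosDef) (v : k → ℝ) (b : k) : v b ^ 2 ≤ G b b * (v ⬝ᵥ G⁻¹ *ᵥ v) := by
  have hgb : 0 < G b b := hG.diag_pos
  have hdet : IsUnit G.det := hG.det_pos.ne'.isUnit
  have hsymm : G⁻¹ᵀ = G⁻¹ := by simpa using hG.inv.isHermitian.eq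
  set u := G *ᵥ Pi.single b 1 with hu
  have hAu : G⁻¹ *ᵥ u = Pi.single b 1 := by
    rw [hu, mulVec_mulVec, nonsing_inv_mul _ hdet, one_mulVec]
  have hvu : v ⬝ᵥ G⁻¹ *ᵥ u = v b := by rw [hAu]; simp
  have huv : u ⬝ᵥ G⁻¹ *ᵥ v = v b := by
    rw [dotProduct_mulVec, ← mulVec_transpose, hsymm, hAu]; simp
  have huu : u ⬝ᵥ G⁻¹ *ᵥ u = G b b := by rw [hAu]; simp [hu]
  have key := hG.inv.posSemidef.dotProduct_mulVec_nonneg (v - (v b / G b b) • u)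
  simp only [star_trivial, mulVec_sub, mulVec_smul, dotProduct_sub, sub_dotProduct,
    dotProduct_smul, smul_dotProduct, hvu, huv, huu, smul_eq_mul] at key
  have e : v b / G b b * G b b = v b := div_mul_cancel₀ _ hgb.ne'
  rw [e] at key
  have h2 : v b / G b b * v b ≤ v ⬝ᵥ G⁻¹ *ᵥ v := by linarith
  rw [div_mul_eq_mul_div, div_le_iff₀ hgb] at h2
  nlinarith

namespace FermiTube

variable {ι : Type*} (T : FermiTube ι)

open Matrix in
-- The previous inequality is summed over the real and imaginary parts of the two spinor components.
lemma norm_sq_le_gradSq (Dψ : Fin 3 → ι → ℝ × ℂ → Spinor) (j : ι) {w : ℝ × ℂ}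
    (hw : ‖w.2‖ < T.R) (b : Fin 3) :
    ‖Dψ b j w‖ ^ 2 ≤ T.g j w b b * T.gradSq Dψ j w := by
  have hG := T.g_posDef j w hw
  have h1 : ‖Dψ b j w‖ ^ 2 = ∑ i, ((Dψ b j w i).re ^ 2 + (Dψ b j w i).im ^ 2) := by
    rw [EuclideanSpace.norm_sq_eq]
    refine Finset.sum_congr rfl fun i _ => ?_
    rw [Complex.sq_norm, Complex.normSq_apply]; ring
  have h2 : T.gradSq Dψ j w = ∑ i, (((fun a => (Dψ a j w i).re) ⬝ᵥ
      (T.g j w)⁻¹ *ᵥ fun a => (Dψ a j w i).re) +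
      ((fun a => (Dψ a j w i).im) ⬝ᵥ (T.g j w)⁻¹ *ᵥ fun a => (Dψ a j w i).im)) := by
    simp only [gradSq, dotProduct, mulVec, PiLp.inner_apply, Fin.sum_univ_two, Complex.add_re,
      RCLike.inner_apply, Complex.mul_re, Complex.conj_re, Complex.conj_im, Fin.sum_univ_three]
    ring
  rw [h1, h2, Finset.mul_sum]
  refine Finset.sum_le_sum fun i _ => ?_
  rw [mul_add]
  exact add_le_add (sq_le_mul_dotProduct_inv_mulVec hG (fun a => (Dψ a j w i).re) b)
    (sq_le_mul_dotProduct_inv_mulVec hG (fun a => (Dψ a j w i).im) b)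

/-- Bounds for the metric over a fundamental domain of the tube. -/
lemma exists_metric_bound (j : ι) : ∃ K : ℝ, 0 < K ∧
    ∀ w : ℝ × ℂ, w ∈ punctured T.r₀ → w.1 ∈ Ioc 0 (T.len j) →
      Real.sqrt (T.g j w).det ≤ K ∧ ∀ b, T.g j w b b ≤ K := by
  -- Since `r₀ < R`, the metric is continuous on this compact closed cylinder.
  set S : Set (ℝ × ℂ) := Icc 0 (T.len j) ×ˢ Metric.closedBall 0 T.r₀ with hS
  have hcpt : IsCompact S := isCompact_Icc.prod (isCompact_closedBall 0 T.r₀)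
  have hsub : S ⊆ {w | ‖w.2‖ < T.R} := fun w hw =>
    (mem_closedBall_zero_iff.1 hw.2).trans_lt T.r₀_lt
  have hg : ∀ a b, ContinuousOn (fun w => T.g j w a b) S := fun a b =>
    (T.g_smooth j a b).continuousOn.mono hsub
  have hg' : ContinuousOn (T.g j) S :=
    continuousOn_pi.2 fun a => continuousOn_pi.2 fun b => hg a b
  have hdet : ContinuousOn (fun w => Real.sqrt (T.g j w).det) S :=
    (Real.continuous_sqrt.comp (Continuous.matrix_det continuous_id)).comp_continuousOn hg'
  obtain ⟨K, hK⟩ := hcpt.exists_bound_of_continuousOn hdet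
  choose K' hK' using fun b => hcpt.exists_bound_of_continuousOn (hg b b)
  refine ⟨|K| + ∑ b, |K' b| + 1, by positivity, fun w hw hw1 => ?_⟩
  have hwS : w ∈ S := ⟨Ioc_subset_Icc_self hw1, mem_closedBall_zero_iff.2 hw.2.le⟩
  have hsum : 0 ≤ ∑ b, |K' b| := by positivity
  refine ⟨?_, fun b => ?_⟩
  · have := (le_abs_self _).trans (hK w hwS)
    linarith [le_abs_self K]
  · have h1 := (le_abs_self _).trans (hK' b w hwS)
    have h2 := Finset.single_le_sum (f := fun b => |K' b|) (fun _ _ => abs_nonneg _)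
      (Finset.mem_univ b)
    linarith [le_abs_self (K' b), abs_nonneg K]

/-! ### From mode estimates to estimates of the terms on the tube. -/

section Terms

variable (c : CutOffs T.r₀) {σ : ι → ℝ × ℂ → (Spinor →L[ℝ] Spinor)}

lemma enorm_term_sq_le {Ks : ℝ} (hKs : ∀ j, ∀ w ∈ punctured T.r₀, ‖σ j w‖ ≤ Ks) (β : ℝ) {m : ℕ}
    (μ : Fin m → Fin 3) (n : ℕ) (Ψ : ι → ℝ × ℂ → Spinor) (η : ι → ℝ → ℂ) (j : ι) {w : ℝ × ℂ}
    (hw : w ∈ punctured T.r₀) :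
    ‖T.term c β μ n σ Ψ η j w‖ₑ ^ 2 ≤ ENNReal.ofReal (Ks ^ 2) *
      (ENNReal.ofReal (‖w.2‖ ^ (2 * β)) *
        ‖modeOp (T.len j) (c.modeDeriv μ) (iteratedDeriv n (η j)) w‖ₑ ^ 2 * ‖Ψ j w‖ₑ ^ 2) := by
  have hKs0 : 0 ≤ Ks := (norm_nonneg _).trans (hKs j w hw)
  simp only [← ofReal_norm]
  rw [← ENNReal.ofReal_pow (norm_nonneg _), ← ENNReal.ofReal_pow (norm_nonneg _),
    ← ENNReal.ofReal_pow (norm_nonneg _), ← ENNReal.ofReal_mul (by positivity),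
    ← ENNReal.ofReal_mul (by positivity), ← ENNReal.ofReal_mul (by positivity)]
  refine ENNReal.ofReal_le_ofReal ?_
  have h1 : ‖σ j w (Ψ j w)‖ ≤ Ks * ‖Ψ j w‖ :=
    ((σ j w).le_opNorm _).trans (mul_le_mul_of_nonneg_right (hKs j w hw) (norm_nonneg _))
  rw [term, norm_smul, norm_smul, Real.norm_of_nonneg (by positivity)]
  calc _ ≤ (‖w.2‖ ^ β * (‖modeOp (T.len j) (c.modeDeriv μ) (iteratedDeriv n (η j)) w‖ *
        (Ks * ‖Ψ j w‖))) ^ 2 := by gcongr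
    _ = Ks ^ 2 * ((‖w.2‖ ^ β) ^ 2 *
        ‖modeOp (T.len j) (c.modeDeriv μ) (iteratedDeriv n (η j)) w‖ ^ 2 * ‖Ψ j w‖ ^ 2) := by ring
    _ = _ := by
        rw [← Real.rpow_mul_natCast (norm_nonneg w.2), mul_comm β]
        norm_num

variable [Fintype ι]

lemma sobolevNorm_eq (s : ℝ) (η : ι → ℝ → ℂ) : T.sobolevNorm s η =
    (∑ j, ENNReal.ofReal (T.len j) * sobolevSq (T.len j) s (η j)) ^ (1 / 2 : ℝ) := rfl

/-- A bound for the squares of the components gives a bound for the norms. -/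
lemma tubeL2_le_of_forall {F : ι → ℝ × ℂ → Spinor} {C : ι → ℝ≥0} {X : ι → ℝ≥0∞}
    (h : ∀ j, ∫⁻ w in {w | w ∈ punctured T.r₀ ∧ w.1 ∈ Ioc 0 (T.len j)},
      ‖F j w‖ₑ ^ 2 * ENNReal.ofReal (Real.sqrt (T.g j w).det) ≤ C j * X j) :
    T.tubeL2 F ≤ ((∑ j, C j) ^ (1 / 2 : ℝ) : ℝ≥0) * (∑ j, X j) ^ (1 / 2 : ℝ) := by
  rw [ENNReal.coe_rpow_of_nonneg _ (by norm_num), ← ENNReal.mul_rpow_of_nonneg _ _ (by norm_num)]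
  refine ENNReal.rpow_le_rpow ?_ (by norm_num)
  rw [tubeIntegral, Finset.mul_sum]
  refine Finset.sum_le_sum fun j _ => (h j).trans ?_
  gcongr
  exact Finset.single_le_sum (f := C) (fun _ _ => zero_le) (Finset.mem_univ j)

/-- The estimate for spinors with a pointwise bound `|Ψ| ≤ K r^e`. -/
lemma exists_tubeL2_term_le_of_pointwise (hσ : T.IsEndomorphism σ) (β : ℝ) {m : ℕ}
    (μ : Fin m → Fin 3) (n : ℕ) (e K : ℝ) {s : ℝ} (h : m = 0 → -1 < β + e)
    (hs : (m : ℝ) + n - (1 + (β + e)) ≤ s) :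
    ∃ C : ℝ≥0, ∀ Ψ : ι → ℝ × ℂ → Spinor,
      (∀ j, ∀ w ∈ punctured T.r₀, ‖Ψ j w‖ ≤ K * ‖w.2‖ ^ e) →
      ∀ η, T.IsSmoothSection η →
        T.tubeL2 (T.term c β μ n σ Ψ η) ≤ C * T.sobolevNorm s η := by
  obtain ⟨Ks, hKs⟩ := hσ.2
  choose Kg hKg0 hKg using T.exists_metric_bound
  choose C hC using fun j => c.exists_lintegral_modeOp_le T.r₀_pos (T.len_pos j) μ n h hs
  refine ⟨(∑ j, (Ks ^ 2 * K ^ 2 * Kg j).toNNReal * C j) ^ (1 / 2 : ℝ), fun Ψ hΨ η hη => ?_⟩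
  refine T.tubeL2_le_of_forall fun j => ?_
  calc _ ≤ ∫⁻ w in {w | w ∈ punctured T.r₀ ∧ w.1 ∈ Ioc 0 (T.len j)},
        ENNReal.ofReal (Ks ^ 2 * K ^ 2 * Kg j) * (ENNReal.ofReal (‖w.2‖ ^ (2 * (β + e))) *
          ‖modeOp (T.len j) (c.modeDeriv μ) (iteratedDeriv n (η j)) w‖ₑ ^ 2) := by
        refine setLIntegral_mono' (measurableSet_fundamental_domain _ _) fun w hw => ?_
        have hr : 0 < ‖w.2‖ := hw.1.1
        have hΨ2 : ‖Ψ j w‖ₑ ^ 2 ≤ ENNReal.ofReal (K ^ 2) * ENNReal.ofReal (‖w.2‖ ^ (2 * e)) := by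
          rw [← ofReal_norm, ← ENNReal.ofReal_pow (norm_nonneg _),
            ← ENNReal.ofReal_mul (by positivity)]
          refine ENNReal.ofReal_le_ofReal
            ((pow_le_pow_left₀ (norm_nonneg _) (hΨ j w hw.1) 2).trans_eq ?_)
          rw [mul_pow, ← Real.rpow_mul_natCast hr.le, mul_comm e]; norm_num
        have e1 : ENNReal.ofReal (‖w.2‖ ^ (2 * (β + e))) =
            ENNReal.ofReal (‖w.2‖ ^ (2 * β)) * ENNReal.ofReal (‖w.2‖ ^ (2 * e)) := by
          rw [← ENNReal.ofReal_mul (by positivity), ← Real.rpow_add hr, mul_add]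
        refine (mul_le_mul' ((T.enorm_term_sq_le c hKs β μ n Ψ η j hw.1).trans
          (mul_le_mul_right (mul_le_mul_right hΨ2 _) _))
          (ENNReal.ofReal_le_ofReal (hKg j w hw.1 hw.2).1)).trans_eq ?_
        rw [e1, ENNReal.ofReal_mul (by positivity), ENNReal.ofReal_mul (by positivity)]
        ring
    _ ≤ ENNReal.ofReal (Ks ^ 2 * K ^ 2 * Kg j) *
          (C j * (ENNReal.ofReal (T.len j) * sobolevSq (T.len j) s (η j))) := by
        rw [lintegral_const_mul' _ _ ENNReal.ofReal_ne_top]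
        exact mul_le_mul_right (hC j (η j) (hη j).1 (hη j).2) _
    _ = _ := by
        rw [ENNReal.coe_mul, ← mul_assoc]; rfl

/-- The estimate for spinors that are bounded by `r^e` times an `L²` function. -/
lemma exists_tubeL2_term_le_of_lintegral (hσ : T.IsEndomorphism σ) (β : ℝ) {m : ℕ}
    (μ : Fin m → Fin 3) (n : ℕ) (e : ℝ) (K : ι → ℝ≥0) {γ : ℝ} (hγ : 0 < γ)
    (h : m = 0 → 0 ≤ β + e) :
    ∃ C : ℝ≥0, ∀ (Ψ : ι → ℝ × ℂ → Spinor) (G : ι → ℝ × ℂ → ℝ≥0∞),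
      (∀ j w, w ∈ punctured T.r₀ → w.1 ∈ Ioc 0 (T.len j) →
        ‖Ψ j w‖ₑ ^ 2 ≤ K j * (ENNReal.ofReal (‖w.2‖ ^ (2 * e)) * G j w)) →
      ∀ η, T.IsSmoothSection η →
        T.tubeL2 (T.term c β μ n σ Ψ η) ≤
          C * T.sobolevNorm ((m : ℝ) + n + γ - (β + e) + 1 / 2) η *
            T.tubeIntegral G ^ (1 / 2 : ℝ) := by
  obtain ⟨Ks, hKs⟩ := hσ.2
  choose C hC using fun j => c.exists_modeOp_le T.r₀_pos (T.len_pos j) μ n hγ h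
  set s := (m : ℝ) + n + γ - (β + e) + 1 / 2
  refine ⟨(∑ j, (Ks ^ 2).toNNReal * K j * C j) ^ (1 / 2 : ℝ), fun Ψ G hΨ η hη => ?_⟩
  -- Each component is bounded with the full norm `Q`, so that summing over `j` gives a product of
  -- `Q` and the full integral of `G`.
  set Q := ∑ j, ENNReal.ofReal (T.len j) * sobolevSq (T.len j) s (η j) with hQ
  have hQj : ∀ j, ENNReal.ofReal (T.len j) * sobolevSq (T.len j) s (η j) ≠ ⊤ := fun j =>
    ENNReal.mul_ne_top ENNReal.ofReal_ne_top
      (sobolevSq_ne_top (T.len_pos j) s (hη j).1 (hη j).2)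
  have hQtop : Q ≠ ⊤ := ENNReal.sum_ne_top.2 fun j _ => hQj j
  rw [mul_assoc, sobolevNorm_eq, ← ENNReal.mul_rpow_of_nonneg _ _ (by norm_num), tubeIntegral,
    Finset.mul_sum]
  refine T.tubeL2_le_of_forall fun j => ?_
  calc _ ≤ ∫⁻ w in {w | w ∈ punctured T.r₀ ∧ w.1 ∈ Ioc 0 (T.len j)},
        (ENNReal.ofReal (Ks ^ 2) * K j * C j * Q) *
          (G j w * ENNReal.ofReal (Real.sqrt (T.g j w).det)) := by
        refine setLIntegral_mono' (measurableSet_fundamental_domain _ _) fun w hw => ?_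
        have hr : 0 < ‖w.2‖ := hw.1.1
        have e1 : ENNReal.ofReal (‖w.2‖ ^ (2 * (β + e))) =
            ENNReal.ofReal (‖w.2‖ ^ (2 * β)) * ENNReal.ofReal (‖w.2‖ ^ (2 * e)) := by
          rw [← ENNReal.ofReal_mul (by positivity), ← Real.rpow_add hr, mul_add]
        have hQle : ENNReal.ofReal (T.len j) * sobolevSq (T.len j) s (η j) ≤ Q :=
          Finset.single_le_sum
            (f := fun j => ENNReal.ofReal (T.len j) * sobolevSq (T.len j) s (η j))
            (fun _ _ => zero_le) (Finset.mem_univ j)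
        have hmode := (hC j (η j) (hη j).1 (hη j).2 w hw.1).trans (mul_le_mul_right hQle _)
        set M := ‖modeOp (T.len j) (c.modeDeriv μ) (iteratedDeriv n (η j)) w‖ₑ ^ 2
        calc _ ≤ ENNReal.ofReal (Ks ^ 2) * (ENNReal.ofReal (‖w.2‖ ^ (2 * β)) * M *
              (K j * (ENNReal.ofReal (‖w.2‖ ^ (2 * e)) * G j w))) *
                ENNReal.ofReal (Real.sqrt (T.g j w).det) :=
              mul_le_mul_left ((T.enorm_term_sq_le c hKs β μ n Ψ η j hw.1).trans
                (mul_le_mul_right (mul_le_mul_right (hΨ j w hw.1 hw.2) _) _)) _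
          _ = ENNReal.ofReal (Ks ^ 2) * K j * (ENNReal.ofReal (‖w.2‖ ^ (2 * (β + e))) * M) *
                (G j w * ENNReal.ofReal (Real.sqrt (T.g j w).det)) := by rw [e1]; ring
          _ ≤ ENNReal.ofReal (Ks ^ 2) * K j * (C j * Q) *
                (G j w * ENNReal.ofReal (Real.sqrt (T.g j w).det)) := by gcongr
          _ = _ := by ring
    _ = _ := by
        rw [lintegral_const_mul' _ _ (ENNReal.mul_ne_top (ENNReal.mul_ne_top (ENNReal.mul_ne_top
          ENNReal.ofReal_ne_top ENNReal.coe_ne_top) ENNReal.coe_ne_top) hQtop)]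
        rw [ENNReal.coe_mul, ENNReal.coe_mul, mul_assoc _ Q]; rfl

/-- Only the `l` normal derivatives lower the power of `r`, so the pointwise estimate gives the
exponent `m + n + l - (1 + α + β)`. This is at most the stated one because `l` does not exceed the
order. -/
lemma exists_tubeL2_term_applyDeriv_le (hσ : T.IsEndomorphism σ) (α β : ℝ) (K : SpinorDeriv → ℝ)
    {m : ℕ} (μ : Fin m → Fin 3) (n : ℕ) (d : SpinorDeriv) {s : ℝ}
    (h : m = 0 → (d.normalOrder : ℝ) < 1 + α + β)
    (hs : ((m + n + d.order : ℕ) : ℝ) - (1 + α + β) ≤ s) :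
    ∃ C : ℝ≥0, ∀ Φ, T.HasSpinorBounds α K Φ → ∀ η, T.IsSmoothSection η →
      T.tubeL2 (T.term c β μ n σ (T.applyDeriv d Φ) η) ≤ C * T.sobolevNorm s η := by
  have hd : (d.normalOrder : ℝ) ≤ d.order := by
    cases d <;> simp [SpinorDeriv.normalOrder, SpinorDeriv.order]
  obtain ⟨C, hC⟩ := T.exists_tubeL2_term_le_of_pointwise c hσ β μ n (α - d.normalOrder) (K d)
    (s := s) (fun hm => by linarith [h hm]) (by push_cast at hs; linarith)
  exact ⟨C, fun Φ hΦ η hη => hC _ (hΦ.2 d) η hη⟩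

lemma exists_tubeL2_term_covD_le (hσ : T.IsEndomorphism σ) (α β : ℝ) (K : SpinorDeriv → ℝ)
    {m : ℕ} (μ : Fin m → Fin 3) (n : ℕ) (b : Fin 3) {s : ℝ}
    (h : m = 0 → -1 < α + β ∧ (b ≠ 0 → 0 < α + β))
    (hs : ((m + n + 1 : ℕ) : ℝ) - (1 + α + β) ≤ s) :
    ∃ C : ℝ≥0, ∀ Φ, T.HasSpinorBounds α K Φ → ∀ η, T.IsSmoothSection η →
      T.tubeL2 (T.term c β μ n σ (T.covD b Φ) η) ≤ C * T.sobolevNorm s η := by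
  induction b using Fin.cases with
  | zero =>
    exact T.exists_tubeL2_term_applyDeriv_le c hσ α β K μ n (.tangential 1)
      (fun hm => by
        have := (h hm).1
        simp only [SpinorDeriv.normalOrder, Nat.cast_zero]
        linarith) hs
  | succ v =>
    exact T.exists_tubeL2_term_applyDeriv_le c hσ α β K μ n (.mixed 0 v)
      (fun hm => by
        have := (h hm).2 (Fin.succ_ne_zero v)
        simp only [SpinorDeriv.normalOrder, Nat.cast_one]
        linarith) hs

/-- The estimate for a spinor `ψ` with `ψ / r ∈ L²`. -/
lemma exists_tubeL2_term_le_quotL2 (hσ : T.IsEndomorphism σ) (β : ℝ) {m : ℕ}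
    (μ : Fin m → Fin 3) (n : ℕ) {γ : ℝ} (hγ : 0 < γ) (h : m = 0 → -1 ≤ β) {s : ℝ}
    (hs : s = ((m + n : ℕ) : ℝ) + γ - (1 / 2 + β)) :
    ∃ C : ℝ≥0, ∀ ψ, ∀ η, T.IsSmoothSection η →
      T.tubeL2 (T.term c β μ n σ ψ η) ≤ C * T.sobolevNorm s η * T.quotL2 ψ := by
  -- Writing `ψ = r · (ψ / r)` gains one power of `r`, which turns the condition `δ ≥ 0` into `β ≥
  -- -1`.
  obtain ⟨C, hC⟩ := T.exists_tubeL2_term_le_of_lintegral c hσ β μ n 1 (fun _ => 1) hγ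
    (fun hm => by linarith [h hm])
  have hs' : (m : ℝ) + n + γ - (β + 1) + 1 / 2 = s := by rw [hs]; push_cast; ring
  rw [hs'] at hC
  refine ⟨C, fun ψ η hη => hC ψ _ (fun j w hw _ => ?_) η hη⟩
  have hr : 0 < ‖w.2‖ := hw.1
  rw [enorm_smul, mul_pow, ENNReal.coe_one, one_mul, ← mul_assoc, ← ofReal_norm (‖w.2‖⁻¹),
    ← ENNReal.ofReal_pow (norm_nonneg _), ← ENNReal.ofReal_mul (by positivity)]
  have e : ‖w.2‖ ^ (2 * (1 : ℝ)) * ‖‖w.2‖⁻¹‖ ^ 2 = 1 := by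
    rw [norm_inv, norm_norm, mul_one, Real.rpow_two]
    field_simp
  rw [e, ENNReal.ofReal_one, one_mul]

/-- The estimate for a derivative of a spinor `ψ` with `∇ψ ∈ L²`. -/
lemma exists_tubeL2_term_le_gradL2 (hσ : T.IsEndomorphism σ) (β : ℝ) {m : ℕ}
    (μ : Fin m → Fin 3) (n : ℕ) (b : Fin 3) {γ : ℝ} (hγ : 0 < γ) (h : m = 0 → 0 ≤ β) {s : ℝ}
    (hs : s = ((m + n + 1 : ℕ) : ℝ) + γ - (1 / 2 + β)) :
    ∃ C : ℝ≥0, ∀ Dψ : Fin 3 → ι → ℝ × ℂ → Spinor, ∀ η, T.IsSmoothSection η →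
      T.tubeL2 (T.term c β μ n σ (Dψ b) η) ≤ C * T.sobolevNorm s η * T.gradL2 Dψ := by
  choose Kg hKg0 hKg using T.exists_metric_bound
  -- There is no gain in `r` here; `Kg` bounds `g_bb`, the cost of passing from `|∇ψ|²` to one
  -- coordinate component.
  obtain ⟨C, hC⟩ := T.exists_tubeL2_term_le_of_lintegral c hσ β μ n 0
    (fun j => (Kg j).toNNReal) hγ (fun hm => by linarith [h hm])
  have hs' : (m : ℝ) + n + γ - (β + 0) + 1 / 2 = s := by rw [hs]; push_cast; ring
  rw [hs'] at hC
  refine ⟨C, fun Dψ η hη => hC _ _ (fun j w hw hw1 => ?_) η hη⟩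
  have h1 := T.norm_sq_le_gradSq Dψ j (hw.2.trans T.r₀_lt) b
  have hgb : 0 < T.g j w b b := (T.g_posDef j w (hw.2.trans T.r₀_lt)).diag_pos
  have h2 : 0 ≤ T.gradSq Dψ j w :=
    nonneg_of_mul_nonneg_right ((sq_nonneg _).trans h1) hgb
  rw [mul_zero, Real.rpow_zero, ENNReal.ofReal_one, one_mul, ← ofReal_norm,
    ← ENNReal.ofReal_pow (norm_nonneg _)]
  refine (ENNReal.ofReal_le_ofReal (h1.trans
    (mul_le_mul_of_nonneg_right ((hKg j w hw hw1).2 b) h2))).trans_eq ?_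
  rw [ENNReal.ofReal_mul (hKg0 j).le]; rfl

lemma tubeIntegral_mono {F G : ι → ℝ × ℂ → ℝ≥0∞} (h : ∀ j w, F j w ≤ G j w) :
    T.tubeIntegral F ≤ T.tubeIntegral G :=
  Finset.sum_le_sum fun j _ => lintegral_mono fun w => mul_le_mul_left (h j w) _

lemma quotL2_le_edgeNorm (ψ : ι → ℝ × ℂ → Spinor) (Dψ : Fin 3 → ι → ℝ × ℂ → Spinor) :
    T.quotL2 ψ ≤ T.edgeNorm ψ Dψ := by
  refine ENNReal.rpow_le_rpow (T.tubeIntegral_mono fun j w => ?_) (by norm_num)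
  refine le_trans (le_of_eq ?_) le_add_self
  rw [← ofReal_norm, ← ENNReal.ofReal_pow (norm_nonneg _), norm_smul, norm_inv, norm_norm, mul_pow,
    inv_pow, div_eq_inv_mul]

lemma gradL2_le_edgeNorm (ψ : ι → ℝ × ℂ → Spinor) (Dψ : Fin 3 → ι → ℝ × ℂ → Spinor) :
    T.gradL2 Dψ ≤ T.edgeNorm ψ Dψ :=
  ENNReal.rpow_le_rpow (T.tubeIntegral_mono fun _ _ => le_self_add) (by norm_num)

end Terms

end FermiTube

end ModeDeformation

end

/-! ### The theorem. -/

open ModeDeformation in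
theorem lemma6p9 {ι : Type*} [Fintype ι] (T : FermiTube ι) (c : CutOffs T.r₀)
    (σ : ι → ℝ × ℂ → (Spinor →L[ℝ] Spinor)) (hσ : T.IsEndomorphism σ) (β : ℝ) :
    -- (A)
    (∀ (α : ℝ) (K : SpinorDeriv → ℝ), 0 < α →
      (∀ (m : ℕ) (μ : Fin m → Fin 3) (n : ℕ) (d : SpinorDeriv),
        (m = 0 → (d.normalOrder : ℝ) < 1 + α + β) →
        ∃ C : ℝ≥0, ∀ Φ, T.HasSpinorBounds α K Φ → ∀ η, T.IsSmoothSection η →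
          T.tubeL2 (T.term c β μ n σ (T.applyDeriv d Φ) η) ≤
            C * T.sobolevNorm (((m + n + d.order : ℕ) : ℝ) - (1 + α + β)) η) ∧
      (-1 < α + β → ∀ a b : Fin 3,
        ∃ C : ℝ≥0, ∀ Φ, T.HasSpinorBounds α K Φ → ∀ η, T.IsSmoothSection η →
          T.tubeL2 (T.term c β ![] 2 σ Φ η) + T.tubeL2 (T.term c β ![a] 1 σ Φ η) +
            T.tubeL2 (T.term c β ![a, b] 0 σ Φ η) ≤
              C * T.sobolevNorm (1 - α - β) η) ∧
      (∀ a b : Fin 3, -1 < α + β → (b ≠ 0 → 0 < α + β) →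
        ∃ C : ℝ≥0, ∀ Φ, T.HasSpinorBounds α K Φ → ∀ η, T.IsSmoothSection η →
          T.tubeL2 (T.term c β ![] 1 σ (T.covD b Φ) η) +
            T.tubeL2 (T.term c β ![a] 0 σ (T.covD b Φ) η) ≤
              C * T.sobolevNorm (1 - α - β) η)) ∧
    -- (B)
    (∀ γ : ℝ, 0 < γ →
      (∀ (m : ℕ) (μ : Fin m → Fin 3) (n : ℕ), (m = 0 → -1 ≤ β) →
        ∃ C : ℝ≥0, ∀ ψ Dψ, T.MemEdgeH1 ψ Dψ → ∀ η, T.IsSmoothSection η →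
          T.tubeL2 (T.term c β μ n σ ψ η) ≤
            C * T.sobolevNorm (((m + n : ℕ) : ℝ) + γ - (1 / 2 + β)) η * T.edgeNorm ψ Dψ) ∧
      (∀ (m : ℕ) (μ : Fin m → Fin 3) (n : ℕ) (b : Fin 3), (m = 0 → 0 ≤ β) →
        ∃ C : ℝ≥0, ∀ ψ Dψ, T.MemEdgeH1 ψ Dψ → ∀ η, T.IsSmoothSection η →
          T.tubeL2 (T.term c β μ n σ (Dψ b) η) ≤
            C * T.sobolevNorm (((m + n + 1 : ℕ) : ℝ) + γ - (1 / 2 + β)) η *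
              T.edgeNorm ψ Dψ) ∧
      (-1 ≤ β → ∀ a b : Fin 3,
        ∃ C : ℝ≥0, ∀ ψ Dψ, T.MemEdgeH1 ψ Dψ → ∀ η, T.IsSmoothSection η →
          T.tubeL2 (T.term c β ![] 2 σ ψ η) + T.tubeL2 (T.term c β ![a] 1 σ ψ η) +
            T.tubeL2 (T.term c β ![a, b] 0 σ ψ η) ≤
              C * T.sobolevNorm (3 / 2 + γ - β) η * T.quotL2 ψ) ∧
      (0 ≤ β → ∀ a b : Fin 3,
        ∃ C : ℝ≥0, ∀ ψ Dψ, T.MemEdgeH1 ψ Dψ → ∀ η, T.IsSmoothSection η →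
          T.tubeL2 (T.term c β ![] 1 σ (Dψ b) η) + T.tubeL2 (T.term c β ![a] 0 σ (Dψ b) η) ≤
              C * T.sobolevNorm (3 / 2 + γ - β) η * T.gradL2 Dψ)) := by
  refine ⟨fun α K _ => ⟨fun m μ n d h => ?_, fun h a b => ?_, fun a b h hb => ?_⟩,
    fun γ hγ => ⟨fun m μ n h => ?_, fun m μ n b h => ?_, fun h a b => ?_, fun h a b => ?_⟩⟩
  · exact T.exists_tubeL2_term_applyDeriv_le c hσ α β K μ n d h le_rfl
  -- All three terms have weight `2`, with `.tangential 0` standing for `Φ` itself.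
  · have key : ∀ (m : ℕ) (μ : Fin m → Fin 3) (n : ℕ), m + n = 2 →
        ∃ C : ℝ≥0, ∀ Φ, T.HasSpinorBounds α K Φ → ∀ η, T.IsSmoothSection η →
          T.tubeL2 (T.term c β μ n σ Φ η) ≤ C * T.sobolevNorm (1 - α - β) η := fun m μ n hmn =>
      T.exists_tubeL2_term_applyDeriv_le c hσ α β K μ n (.tangential 0)
        (fun _ => by simp only [SpinorDeriv.normalOrder, Nat.cast_zero]; linarith)
        (by simp only [SpinorDeriv.order, hmn]; push_cast; linarith)
    obtain ⟨C₁, h₁⟩ := key 0 ![] 2 rfl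
    obtain ⟨C₂, h₂⟩ := key 1 ![a] 1 rfl
    obtain ⟨C₃, h₃⟩ := key 2 ![a, b] 0 rfl
    refine ⟨C₁ + C₂ + C₃, fun Φ hΦ η hη => ?_⟩
    rw [ENNReal.coe_add, ENNReal.coe_add, add_mul, add_mul]
    exact add_le_add (add_le_add (h₁ Φ hΦ η hη) (h₂ Φ hΦ η hη)) (h₃ Φ hΦ η hη)
  · have key : ∀ (m : ℕ) (μ : Fin m → Fin 3) (n : ℕ), m + n = 1 →
        ∃ C : ℝ≥0, ∀ Φ, T.HasSpinorBounds α K Φ → ∀ η, T.IsSmoothSection η →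
          T.tubeL2 (T.term c β μ n σ (T.covD b Φ) η) ≤
            C * T.sobolevNorm (1 - α - β) η := fun m μ n hmn =>
      T.exists_tubeL2_term_covD_le c hσ α β K μ n b (fun _ => ⟨h, hb⟩)
        (by rw [hmn]; push_cast; linarith)
    obtain ⟨C₁, h₁⟩ := key 0 ![] 1 rfl
    obtain ⟨C₂, h₂⟩ := key 1 ![a] 0 rfl
    refine ⟨C₁ + C₂, fun Φ hΦ η hη => ?_⟩
    rw [ENNReal.coe_add, add_mul]
    exact add_le_add (h₁ Φ hΦ η hη) (h₂ Φ hΦ η hη)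
  · obtain ⟨C, hC⟩ := T.exists_tubeL2_term_le_quotL2 c hσ β μ n hγ h rfl
    exact ⟨C, fun ψ Dψ _ η hη => (hC ψ η hη).trans (by gcongr; exact T.quotL2_le_edgeNorm ψ Dψ)⟩
  · obtain ⟨C, hC⟩ := T.exists_tubeL2_term_le_gradL2 c hσ β μ n b hγ h rfl
    exact ⟨C, fun ψ Dψ _ η hη => (hC Dψ η hη).trans (by gcongr; exact T.gradL2_le_edgeNorm ψ Dψ)⟩
  · have key : ∀ (m : ℕ) (μ : Fin m → Fin 3) (n : ℕ), m + n = 2 →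
        ∃ C : ℝ≥0, ∀ ψ, ∀ η, T.IsSmoothSection η →
          T.tubeL2 (T.term c β μ n σ ψ η) ≤
            C * T.sobolevNorm (3 / 2 + γ - β) η * T.quotL2 ψ := fun m μ n hmn =>
      T.exists_tubeL2_term_le_quotL2 c hσ β μ n hγ (fun _ => h) (by rw [hmn]; push_cast; ring)
    obtain ⟨C₁, h₁⟩ := key 0 ![] 2 rfl
    obtain ⟨C₂, h₂⟩ := key 1 ![a] 1 rfl
    obtain ⟨C₃, h₃⟩ := key 2 ![a, b] 0 rfl
    refine ⟨C₁ + C₂ + C₃, fun ψ Dψ _ η hη => ?_⟩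
    rw [ENNReal.coe_add, ENNReal.coe_add, add_mul, add_mul, add_mul, add_mul]
    exact add_le_add (add_le_add (h₁ ψ η hη) (h₂ ψ η hη)) (h₃ ψ η hη)
  · have key : ∀ (m : ℕ) (μ : Fin m → Fin 3) (n : ℕ), m + n = 1 →
        ∃ C : ℝ≥0, ∀ Dψ : Fin 3 → ι → ℝ × ℂ → Spinor, ∀ η, T.IsSmoothSection η →
          T.tubeL2 (T.term c β μ n σ (Dψ b) η) ≤
            C * T.sobolevNorm (3 / 2 + γ - β) η * T.gradL2 Dψ := fun m μ n hmn =>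
      T.exists_tubeL2_term_le_gradL2 c hσ β μ n b hγ (fun _ => h) (by rw [hmn]; push_cast; ring)
    obtain ⟨C₁, h₁⟩ := key 0 ![] 1 rfl
    obtain ⟨C₂, h₂⟩ := key 1 ![a] 0 rfl
    refine ⟨C₁ + C₂, fun ψ Dψ _ η hη => ?_⟩
    rw [ENNReal.coe_add, add_mul, add_mul]
    exact add_le_add (h₁ Dψ η hη) (h₂ Dψ η hη)
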